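/- Let $F$ be a probability distribution on $[0,\infty)$ such that $R:=\sup\{r\ge 0:\int_0^\infty e^{rx}\,dF(x)<\infty\}\in(0,\infty]$, and set $g(z)=\int_0^\infty e^{zx}\,dF(x)$ for $\operatorname{Re} z<R$, $\mu=\int_0^\infty x\,dF(x)$, $\mu_2=\int_0^\infty x^2\,dF(x)$. Let $U(x)=\sum_{n=0}^\infty F^{*n}(x)$ be the renewal function, where $F^{*n}(x)$ denotes the mass that the $n$-fold convolution power of $F$ gives to $(-\infty,x]$ and $F^{*0}=\delta_0$, and put $$v(x)=U(x)-\frac{x}{\mu}-\frac{\mu_2}{2\mu^2}.$$ Suppose that $F$ is non-lattice, i.e. for no $h>0$ is $F$ supported by $\{0,h,2h,\dots\}$. Let $R_0\in(0,R)$ be such that $$\limsup_{\theta\to\pm\infty}\ \sup_{0\le r\le R_0}\left|\frac{1}{1-g(r+i\theta)}\right|<\infty ,$$ where $|1/(1-g(z))|$ is read as $+\infty$ when $g(z)=1$. Then the equation $g(z)=1$ has finitely many (distinct) solutions $z_0=0,z_1,\dots,z_N$ in the half-plane $\operatorname{Re} z<R_0$. If moreover no solution lies on the line $\operatorname{Re}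 z=R_0$, then $$v(x)=\sum_{j=1}^N \operatorname{Res}\left(\frac{e^{-xz}}{z(1-g(z))};z_j\right)+o(e^{-R_0x})\qquad\text{as }x\to+\infty .$$ If $j\ge 1$ and $z_j$ is a simple zero of $g-1$, i.e. $g'(z_j)\ne 0$, then the $j$-th term of the sum equals $-\dfrac{e^{-xz_j}}{z_j\,g'(z_j)}$. -/

import Mathlib

open MeasureTheory ProbabilityTheory Filter Asymptotics
open scoped Topology ENNReal NNReal Real

namespace Renewal

noncomputable section

/-- The `n`-fold convolution power `F^{*n}` of a measure on `ℝ`, with `F^{*0} = δ₀`. -/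
def convPow (F : Measure ℝ) : ℕ → Measure ℝ
  | 0 => Measure.dirac 0
  | n + 1 => Measure.conv (convPow F n) F

/-- The renewal function `U(x) = ∑_{n ≥ 0} F^{*n}(x)`, where a distribution is evaluated at `x`
through its cumulative distribution function. -/
def renewalFunction (F : Measure ℝ) (x : ℝ) : ℝ≥0∞ :=
  ∑' n : ℕ, convPow F n (Set.Iic x)

/-- `R = sup {r ≥ 0 ; ∫ e^{rx} dF(x) < ∞}`, possibly infinite. -/
def abscissa (F : Measure ℝ) : ℝ≥0∞ :=
  ⨆ (r : ℝ≥0) (_ : ∫⁻ x, ENNReal.ofReal (Real.exp (r * x)) ∂F < ∞), (r : ℝ≥0∞)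

/-- `F` is lattice if it is supported by `{0, h, 2h, …}` for some `h > 0`. -/
def IsLattice (F : Measure ℝ) : Prop :=
  ∃ h : ℝ, 0 < h ∧ F (Set.range fun n : ℕ => (n : ℝ) * h)ᶜ = 0

/-- The condition `limsup_{θ → ±∞} sup_{0 ≤ r ≤ R₀} |1 / (1 - g(r + iθ))| < ∞`, where
`g(z) = ∫ e^{zx} dF(x)`. The modulus is taken in `[0, ∞]`, so that it is `∞` where `g = 1`. -/
def UniformlyStronglyNonlattice (F : Measure ℝ) (R₀ : ℝ) : Prop :=
  limsup (fun θ : ℝ => ⨆ r ∈ Set.Icc (0 : ℝ) R₀,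
    ‖1 - complexMGF id F ((r : ℂ) + Complex.I * (θ : ℂ))‖ₑ⁻¹) (atBot ⊔ atTop) < ∞

/-- The mean `μ` of `F`. -/
def mean (F : Measure ℝ) : ℝ := ∫ x, x ∂F

/-- The second moment `μ₂` of `F`. -/
def secondMoment (F : Measure ℝ) : ℝ := ∫ x, x ^ 2 ∂F

/-- `v(x) = U(x) - x/μ - μ₂/(2μ²)` (for non-lattice `F`). -/
def renewalRemainder (F : Measure ℝ) (x : ℝ) : ℝ :=
  (renewalFunction F x).toReal - x / mean F - secondMoment F / (2 * mean F ^ 2)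

/-- The residue of `f` at an isolated singularity `z₀`: the common value of
`(2πi)⁻¹ ∮_{|z - z₀| = ε} f(z) dz` for all small `ε > 0`. -/
def residue (f : ℂ → ℂ) (z₀ : ℂ) : ℂ :=
  limUnder (𝓝[>] (0 : ℝ)) fun ε : ℝ =>
    (2 * (π : ℂ) * Complex.I)⁻¹ * ∮ z in C(z₀, ε), f z

end

end Renewal

/-! For Re z < 0, Fubini and a geometric series give ∫₀^∞ e^{zx} U(x) dx = -1/(z(1 - g(z)))
(`laplace_renewalFunction`). Some exponential moment of order R₁ > R₀ is finite, so the right side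
is meromorphic for Re z < R₁. Since g is Lipschitz on smaller half-planes, the lower bound for |1 -
g| at large |Im z| survives in a slightly wider strip -ε ≤ Re z ≤ R₀ + ε
(`exists_bound_wider_strip`). The zeros of 1 - g there lie in a compact set, so they are finitely
many, and some b > R₀ has no further zero with R₀ ≤ Re z ≤ b.

A principal-part term (z - ζ)^{-(k+1)} is minus the transform of the exponential monomial that is
the residue of e^{-xz}(z - ζ)^{-(k+1)} at ζ (`laplace_expMonomial`). Hence U minus the sum of
residues, cut off at 0, has a transform analytic near -ε ≤ Re z ≤ b and O(1/|Im z|) there.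

That decay just fails to be integrable. Averaging over [x, x + η] adds a factor of size (η|z|)^{-δ};
Fourier inversion and a shift of the line to Re z = b then bound the averages by e^{-bx} η^{-δ}
(`exists_norm_integral_box_le`). Because U is monotone, the remainder falls by at most L e^x η over
a length η, so averages control values (`abs_le_of_integral_box_le`). Taking η = e^{-(b+1)x} and δ
small leaves an error e^{-rx} with r > R₀. The double pole at 0 has residue x/μ + μ₂/(2μ²), which is
what v subtracts from U. -/

namespace Renewal

/-! ### Residues and principal parts -/

/-- `f` is integrable on all small circles around `z₀`, with normalised integral `c`. -/
def HasResidue (f : ℂ → ℂ) (z₀ c : ℂ) : Prop :=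
  ∀ᶠ ε in 𝓝[>] (0 : ℝ), CircleIntegrable f z₀ ε ∧
    (2 * (π : ℂ) * Complex.I)⁻¹ * ∮ z in C(z₀, ε), f z = c

lemma HasResidue.residue_eq {f : ℂ → ℂ} {z₀ c : ℂ} (h : HasResidue f z₀ c) :
    residue f z₀ = c := by
  apply Tendsto.limUnder_eq
  refine tendsto_const_nhds.congr' ?_
  filter_upwards [h] with ε hε using hε.2.symm

lemma HasResidue.add {f₁ f₂ : ℂ → ℂ} {z₀ c₁ c₂ : ℂ} (h₁ : HasResidue f₁ z₀ c₁)
    (h₂ : HasResidue f₂ z₀ c₂) : HasResidue (fun z => f₁ z + f₂ z) z₀ (c₁ + c₂) := by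
  filter_upwards [h₁, h₂] with ε h₁ h₂
  refine ⟨h₁.1.add h₂.1, ?_⟩
  rw [circleIntegral.integral_add h₁.1 h₂.1, mul_add, h₁.2, h₂.2]

lemma HasResidue.const_mul {f : ℂ → ℂ} {z₀ c : ℂ} (h : HasResidue f z₀ c) (a : ℂ) :
    HasResidue (fun z => a * f z) z₀ (a * c) := by
  filter_upwards [h] with ε h
  refine ⟨h.1.const_fun_smul (a := a), ?_⟩
  rw [circleIntegral.integral_const_mul, mul_left_comm, h.2]

lemma eventually_sphere_of_eventually_punctured {z₀ : ℂ} {p : ℂ → Prop}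
    (h : ∀ᶠ z in 𝓝[≠] z₀, p z) :
    ∀ᶠ ε in 𝓝[>] (0 : ℝ), ∀ z ∈ Metric.sphere z₀ ε, p z := by
  rw [eventually_nhdsWithin_iff, Metric.eventually_nhds_iff] at h
  obtain ⟨δ, hδ, h⟩ := h
  filter_upwards [Ioo_mem_nhdsGT hδ] with ε hε z hz
  rw [Metric.mem_sphere] at hz
  refine h (by rw [hz]; exact hε.2) ?_
  rintro rfl
  rw [dist_self] at hz
  exact hε.1.ne hz

lemma HasResidue.congr {f₁ f₂ : ℂ → ℂ} {z₀ c : ℂ} (h : HasResidue f₁ z₀ c)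
    (heq : f₂ =ᶠ[𝓝[≠] z₀] f₁) : HasResidue f₂ z₀ c := by
  filter_upwards [h, eventually_sphere_of_eventually_punctured heq, self_mem_nhdsWithin]
    with ε h he hε
  have hε' : (0 : ℝ) ≤ ε := le_of_lt hε
  refine ⟨?_, ?_⟩
  · refine h.1.congr fun θ _ => ?_
    exact (he _ (by simp [abs_of_nonneg hε'])).symm
  · rw [circleIntegral.integral_congr hε' he, h.2]

lemma hasResidue_zero (z₀ : ℂ) : HasResidue (fun _ => 0) z₀ 0 := by
  refine Eventually.of_forall fun ε => ⟨(continuous_const.continuousOn).circleIntegrable', ?_⟩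
  simp [circleIntegral]

lemma HasResidue.sum {ι : Type*} {f : ι → ℂ → ℂ} {z₀ : ℂ} {c : ι → ℂ} (s : Finset ι)
    (h : ∀ i ∈ s, HasResidue (f i) z₀ (c i)) :
    HasResidue (fun z => ∑ i ∈ s, f i z) z₀ (∑ i ∈ s, c i) := by
  classical
  induction s using Finset.induction_on with
  | empty => simpa using hasResidue_zero z₀
  | insert i s hi ih =>
    simp only [Finset.sum_insert hi]
    exact (h i (by simp)).add (ih fun j hj => h j (by simp [hj]))

lemma eventually_differentiableOn_closedBall {ψ : ℂ → ℂ} {z₀ : ℂ} (hψ : AnalyticAt ℂ ψ z₀) :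
    ∀ᶠ ε in 𝓝[>] (0 : ℝ), DifferentiableOn ℂ ψ (Metric.closedBall z₀ ε) := by
  obtain ⟨δ, hδ, h⟩ := Metric.eventually_nhds_iff.1 hψ.eventually_analyticAt
  filter_upwards [Ioo_mem_nhdsGT hδ] with ε hε z hz
  exact (h (lt_of_le_of_lt hz hε.2)).differentiableAt.differentiableWithinAt

lemma hasResidue_of_analyticAt {ψ : ℂ → ℂ} {z₀ : ℂ} (hψ : AnalyticAt ℂ ψ z₀) :
    HasResidue ψ z₀ 0 := by
  filter_upwards [eventually_differentiableOn_closedBall hψ, self_mem_nhdsWithin] with ε h hε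
  have hε' : (0 : ℝ) < ε := hε
  refine ⟨(h.continuousOn.mono Metric.sphere_subset_closedBall).circleIntegrable hε'.le, ?_⟩
  rw [(DifferentiableOn.diffContOnCl (by rwa [closure_ball _ hε'.ne'])).circleIntegral_eq_zero
    hε'.le, mul_zero]

/-- Cauchy's formula for derivatives, as the residue at a pole of order at most `n + 1`. -/
lemma hasResidue_inv_pow_mul {ψ : ℂ → ℂ} {z₀ : ℂ} (hψ : AnalyticAt ℂ ψ z₀) (n : ℕ) :
    HasResidue (fun z => ((z - z₀)⁻¹) ^ (n + 1) * ψ z) z₀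
      ((n.factorial : ℂ)⁻¹ * iteratedDeriv n ψ z₀) := by
  filter_upwards [eventually_differentiableOn_closedBall hψ, self_mem_nhdsWithin] with ε h hε
  have hε' : (0 : ℝ) < ε := hε
  refine ⟨ContinuousOn.circleIntegrable hε'.le ?_, ?_⟩
  · refine ContinuousOn.mul (ContinuousOn.pow (ContinuousOn.inv₀ (by fun_prop) ?_) _)
      (h.continuousOn.mono Metric.sphere_subset_closedBall)
    intro z hz h0
    rw [sub_eq_zero] at h0
    subst h0
    simp [hε'.ne] at hz
  · have := (DifferentiableOn.diffContOnCl (s := Metric.ball z₀ ε)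
      (by rwa [closure_ball _ hε'.ne'])).circleIntegral_one_div_sub_center_pow_smul hε' n
    simp only [smul_eq_mul, one_div, ← inv_pow] at this
    rw [this]
    have : (2 * (π : ℂ) * Complex.I) ≠ 0 := Complex.two_pi_I_ne_zero
    field_simp

/-- `exp (-x z)` times a principal part has residue an exponential polynomial. -/
lemma hasResidue_exp_mul_principalPart {f r : ℂ → ℂ} {ζ : ℂ} {m : ℕ} {a : ℕ → ℂ}
    (hr : AnalyticAt ℂ r ζ)
    (hf : f =ᶠ[𝓝[≠] ζ] fun z => ∑ k ∈ Finset.range m, a k * ((z - ζ)⁻¹) ^ (k + 1) + r z) (x : ℂ) :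
    HasResidue (fun z => Complex.exp (-x * z) * f z) ζ
      (∑ k ∈ Finset.range m, a k * ((-x) ^ k / k.factorial * Complex.exp (-x * ζ))) := by
  have hexp : AnalyticAt ℂ (fun z => Complex.exp (-x * z)) ζ := by fun_prop
  have h := (HasResidue.sum (Finset.range m) (fun k _ =>
    (hasResidue_inv_pow_mul hexp k).const_mul (a k))).add (hasResidue_of_analyticAt (hexp.mul hr))
  have hc : (∑ k ∈ Finset.range m, a k * ((k.factorial : ℂ)⁻¹ *
      iteratedDeriv k (fun z => Complex.exp (-x * z)) ζ)) + 0
      = ∑ k ∈ Finset.range m, a k * ((-x) ^ k / k.factorial * Complex.exp (-x * ζ)) := by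
    rw [add_zero]
    refine Finset.sum_congr rfl fun k _ => ?_
    rw [iteratedDeriv_cexp_const_mul]
    ring
  rw [hc] at h
  refine h.congr ?_
  filter_upwards [hf] with z hz
  rw [hz, mul_add, Finset.mul_sum]
  congr 1
  exact Finset.sum_congr rfl fun k _ => by ring

lemma analyticAt_dslope {G : ℂ → ℂ} {ζ : ℂ} (hG : AnalyticAt ℂ G ζ) :
    AnalyticAt ℂ (dslope G ζ) ζ := by
  rw [Complex.analyticAt_iff_eventually_differentiableAt] at hG ⊢
  have hs := hG
  rw [eventually_iff, mem_nhds_iff] at hs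
  obtain ⟨t, ht, hto, hζ⟩ := hs
  have : DifferentiableOn ℂ (dslope G ζ) t :=
    (Complex.differentiableOn_dslope (hto.mem_nhds hζ)).2
      fun z hz => (ht hz).differentiableWithinAt
  filter_upwards [hto.mem_nhds hζ] with z hz using this.differentiableAt (hto.mem_nhds hz)

lemma eq_add_mul_dslope (G : ℂ → ℂ) (ζ z : ℂ) : G z = G ζ + (z - ζ) * dslope G ζ z := by
  have := sub_smul_dslope G ζ z
  rw [smul_eq_mul] at this
  rw [this]
  ring

/-- Differentiate G(z) = G(ζ) + (z - ζ) d(z) twice at ζ: G'' = 2d'. This is the source of μ₂/2 in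
the residue at 0. -/
lemma deriv_dslope_self {G : ℂ → ℂ} {ζ : ℂ} (hG : AnalyticAt ℂ G ζ) :
    deriv (dslope G ζ) ζ = iteratedDeriv 2 G ζ / 2 := by
  have hd := analyticAt_dslope hG
  have hsub : ∀ z, HasDerivAt (fun z => z - ζ) 1 z := fun z => (hasDerivAt_id z).sub_const ζ
  have h1 : deriv G =ᶠ[𝓝 ζ] fun z => dslope G ζ z + (z - ζ) * deriv (dslope G ζ) z := by
    filter_upwards [hd.eventually_analyticAt] with z hz
    have h := ((hsub z).mul hz.differentiableAt.hasDerivAt).const_add (G ζ)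
    rw [one_mul] at h
    exact (h.congr_of_eventuallyEq (Eventually.of_forall fun y => eq_add_mul_dslope G ζ y)).deriv
  have h2 := hd.differentiableAt.hasDerivAt.add
    ((hsub ζ).mul hd.deriv.differentiableAt.hasDerivAt)
  have h3 : iteratedDeriv 2 G ζ = deriv (deriv G) ζ := by
    rw [iteratedDeriv_succ, iteratedDeriv_one]
  have h4 := (h2.congr_of_eventuallyEq h1).deriv
  rw [h3, h4]
  simp only [sub_self, zero_mul, add_zero, one_mul]
  ring

/-- Induction on the pole order: dividing G - G(ζ) by z - ζ lowers the order by one, and G(ζ)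
becomes the coefficient of the highest power. -/
lemma exists_principalPart_aux (ζ : ℂ) (n : ℕ) : ∀ G : ℂ → ℂ, AnalyticAt ℂ G ζ →
    ∃ (a : ℕ → ℂ) (r : ℂ → ℂ), AnalyticAt ℂ r ζ ∧ ∀ z ≠ ζ, ((z - ζ)⁻¹) ^ n * G z =
      ∑ k ∈ Finset.range n, a k * ((z - ζ)⁻¹) ^ (k + 1) + r z := by
  induction n with
  | zero => intro G hG; exact ⟨0, G, hG, fun z _ => by simp⟩
  | succ n ih =>
    intro G hG
    obtain ⟨a, r, hr, h⟩ := ih _ (analyticAt_dslope hG)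
    refine ⟨Function.update a n (G ζ), r, hr, fun z hz => ?_⟩
    have hz' : z - ζ ≠ 0 := sub_ne_zero.2 hz
    have hG' := eq_add_mul_dslope G ζ z
    rw [Finset.sum_range_succ, Function.update_self]
    have : ∑ k ∈ Finset.range n, Function.update a n (G ζ) k * ((z - ζ)⁻¹) ^ (k + 1)
        = ∑ k ∈ Finset.range n, a k * ((z - ζ)⁻¹) ^ (k + 1) :=
      Finset.sum_congr rfl fun k hk => by
        rw [Function.update_of_ne (Finset.mem_range.1 hk).ne]
    rw [this, add_right_comm, ← h z hz, hG', pow_succ]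
    field_simp
    ring

lemma exists_principalPart {f : ℂ → ℂ} {ζ : ℂ} (hf : MeromorphicAt f ζ) :
    ∃ (n : ℕ) (a : ℕ → ℂ) (r : ℂ → ℂ), AnalyticAt ℂ r ζ ∧
      f =ᶠ[𝓝[≠] ζ] fun z => ∑ k ∈ Finset.range n, a k * ((z - ζ)⁻¹) ^ (k + 1) + r z := by
  obtain ⟨n, hn⟩ := hf
  obtain ⟨a, r, hr, h⟩ := exists_principalPart_aux ζ n _ hn
  refine ⟨n, a, r, hr, ?_⟩
  filter_upwards [self_mem_nhdsWithin] with z hz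
  rw [← h z hz, smul_eq_mul, ← mul_assoc, ← mul_pow, inv_mul_cancel₀ (sub_ne_zero.2 hz), one_pow,
    one_mul]

/-- Subtracting the principal parts at finitely many poles. -/
lemma exists_sub_principalParts {f : ℂ → ℂ} (Z : Finset ℂ) (hf : ∀ ζ ∈ Z, MeromorphicAt f ζ) :
    ∃ (n : ℂ → ℕ) (a : ℂ → ℕ → ℂ) (H : ℂ → ℂ),
      (∀ z ∉ Z, H z =
        f z - ∑ ζ ∈ Z, ∑ k ∈ Finset.range (n ζ), a ζ k * ((z - ζ)⁻¹) ^ (k + 1)) ∧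
      (∀ ζ ∈ Z, AnalyticAt ℂ H ζ) ∧ (∀ z ∉ Z, AnalyticAt ℂ f z → AnalyticAt ℂ H z) ∧
      ∀ ζ ∈ Z, ∃ r : ℂ → ℂ, AnalyticAt ℂ r ζ ∧
        f =ᶠ[𝓝[≠] ζ] fun z => ∑ k ∈ Finset.range (n ζ), a ζ k * ((z - ζ)⁻¹) ^ (k + 1) + r z := by
  classical
  choose! n a r hr hfr using fun ζ hζ => exists_principalPart (hf ζ hζ)
  set P : ℂ → ℂ → ℂ := fun ζ z => ∑ k ∈ Finset.range (n ζ), a ζ k * ((z - ζ)⁻¹) ^ (k + 1)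
    with hP
  have hPan : ∀ ζ z, z ≠ ζ → AnalyticAt ℂ (P ζ) z := by
    intro ζ z hz
    refine Finset.analyticAt_fun_sum _ fun k _ => analyticAt_const.mul (AnalyticAt.pow ?_ _)
    exact AnalyticAt.inv (by fun_prop) (sub_ne_zero.2 hz)
  have hout : ∀ z : ℂ, ∀ᶠ y in 𝓝[≠] z, y ∉ Z := by
    intro z
    have : ((Z.erase z : Finset ℂ) : Set ℂ)ᶜ ∈ 𝓝 z :=
      (Z.erase z).finite_toSet.isClosed.isOpen_compl.mem_nhds (by simp)
    filter_upwards [mem_nhdsWithin_of_mem_nhds this, self_mem_nhdsWithin] with y hy hyz hyZ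
    exact hy (Finset.mem_coe.2 (Finset.mem_erase.2 ⟨hyz, hyZ⟩))
  -- At a pole the singularity is removed by hand: the value is that of the regular part there minus
  -- the other principal parts.
  refine ⟨n, a, fun z => if z ∈ Z then r z z - ∑ ζ ∈ Z.erase z, P ζ z
    else f z - ∑ ζ ∈ Z, P ζ z, fun z hz => by simp [hz, hP], fun ζ hζ => ?_, fun z hz hfz => ?_,
    fun ζ hζ => ⟨r ζ, hr ζ hζ, hfr ζ hζ⟩⟩
  · have han : AnalyticAt ℂ (fun z => r ζ z - ∑ ζ' ∈ Z.erase ζ, P ζ' z) ζ :=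
      (hr ζ hζ).sub (Finset.analyticAt_fun_sum _ fun ζ' hζ' =>
        hPan ζ' ζ (Finset.ne_of_mem_erase hζ').symm)
    refine han.congr ?_
    have h1 : ∀ᶠ z in 𝓝[≠] ζ, r ζ z - ∑ ζ' ∈ Z.erase ζ, P ζ' z =
        if z ∈ Z then r z z - ∑ ζ ∈ Z.erase z, P ζ z else f z - ∑ ζ ∈ Z, P ζ z := by
      filter_upwards [hfr ζ hζ, hout ζ] with z h1 h2
      rw [if_neg h2, h1, ← Finset.add_sum_erase Z _ hζ]
      ring
    rw [eventually_nhdsWithin_iff] at h1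
    filter_upwards [h1] with z hz
    by_cases h : z = ζ
    · subst h; simp [hζ]
    · exact hz h
  · have han : AnalyticAt ℂ (fun z => f z - ∑ ζ ∈ Z, P ζ z) z :=
      hfz.sub (Finset.analyticAt_fun_sum _ fun ζ hζ => hPan ζ z fun h => hz (h ▸ hζ))
    refine han.congr ?_
    filter_upwards [Z.finite_toSet.isClosed.isOpen_compl.mem_nhds (by simpa using hz)] with y hy
    have hy : y ∉ Z := by simpa using hy
    simp [hy]

/-! ### Moving a vertical line of integration -/

lemma integrable_vertical {G : ℂ → ℂ} {a b B : ℝ}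
    (hG : DifferentiableOn ℂ G {z | a ≤ z.re ∧ z.re ≤ b})
    (hB : ∀ z : ℂ, a ≤ z.re → z.re ≤ b → ‖G z‖ ≤ B / (1 + z.im ^ 2)) {t : ℝ} (hat : a ≤ t)
    (htb : t ≤ b) : Integrable (fun y : ℝ => G (t + y * Complex.I)) := by
  have hc : Continuous (fun y : ℝ => G (t + y * Complex.I)) := by
    rw [← continuousOn_univ]
    refine hG.continuousOn.comp (by fun_prop) fun y _ => by simp [hat, htb]
  refine (integrable_inv_one_add_sq.const_mul B).mono' hc.aestronglyMeasurable
    (Eventually.of_forall fun y => ?_)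
  have := hB (t + y * Complex.I) (by simpa) (by simpa)
  simpa [div_eq_mul_inv] using this

/-- Cauchy's theorem on the rectangle of height 2T; the horizontal sides are O(1/T²). -/
lemma integral_vertical_eq {G : ℂ → ℂ} {a b B : ℝ} (hab : a ≤ b)
    (hG : DifferentiableOn ℂ G {z | a ≤ z.re ∧ z.re ≤ b})
    (hB : ∀ z : ℂ, a ≤ z.re → z.re ≤ b → ‖G z‖ ≤ B / (1 + z.im ^ 2)) :
    ∫ y : ℝ, G (a + y * Complex.I) = ∫ y : ℝ, G (b + y * Complex.I) := by
  have hlim : ∀ t : ℝ, a ≤ t → t ≤ b →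
      Tendsto (fun T : ℝ => ∫ y in (-T)..T, G (t + y * Complex.I)) atTop
        (𝓝 (∫ y : ℝ, G (t + y * Complex.I))) := fun t h1 h2 =>
    intervalIntegral_tendsto_integral (integrable_vertical hG hB h1 h2) tendsto_neg_atTop_atBot
      tendsto_id
  have hhor : ∀ s : ℝ → ℝ, (∀ T, s T ^ 2 = T ^ 2) →
      Tendsto (fun T : ℝ => ∫ x in a..b, G (x + (s T : ℝ) * Complex.I)) atTop (𝓝 0) := by
    intro s hs
    have hbd : ∀ T : ℝ, ‖∫ x in a..b, G (x + (s T : ℝ) * Complex.I)‖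
        ≤ B / (1 + T ^ 2) * |b - a| := by
      intro T
      refine intervalIntegral.norm_integral_le_of_norm_le_const fun x hx => ?_
      rw [Set.uIoc_of_le hab] at hx
      have := hB (x + (s T : ℝ) * Complex.I) (by simpa using hx.1.le) (by simpa using hx.2)
      simpa [hs] using this
    refine squeeze_zero_norm hbd ?_
    have h1 : Tendsto (fun T : ℝ => 1 + T ^ 2) atTop atTop :=
      tendsto_atTop_add_const_left _ _ (tendsto_pow_atTop two_ne_zero)
    simpa using (h1.const_div_atTop B).mul_const |b - a|
  have hrect : ∀ T : ℝ, (∫ x in a..b, G (x + (-T : ℝ) * Complex.I)) -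
      (∫ x in a..b, G (x + (T : ℝ) * Complex.I)) +
      Complex.I * (∫ y in (-T)..T, G (b + y * Complex.I)) -
      Complex.I * (∫ y in (-T)..T, G (a + y * Complex.I)) = 0 := by
    intro T
    have := Complex.integral_boundary_rect_eq_zero_of_differentiableOn G
      (a + (-T : ℝ) * Complex.I) (b + (T : ℝ) * Complex.I) (hG.mono ?_)
    · simpa using this
    · intro z hz
      have := (Complex.mem_reProdIm.1 hz).1
      simpa [Set.uIcc_of_le hab] using this
  have h := (((hhor (fun T => -T) (by simp)).sub (hhor (fun T => T) (by simp))).add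
    ((hlim b hab le_rfl).const_mul Complex.I)).sub ((hlim a le_rfl hab).const_mul Complex.I)
  simp only [hrect] at h
  have h0 := tendsto_nhds_unique h tendsto_const_nhds
  have h1 : Complex.I * ((∫ y : ℝ, G (b + y * Complex.I)) - ∫ y : ℝ, G (a + y * Complex.I)) = 0 := by
    rw [← h0]; ring
  rcases mul_eq_zero.1 h1 with h2 | h2
  · exact absurd h2 Complex.I_ne_zero
  · exact (sub_eq_zero.1 h2).symm

/-! ### The moment generating function of a distribution on `[0, ∞)` -/

lemma ae_nonneg_of_measure_Iio {F : Measure ℝ} (hF : F (Set.Iio 0) = 0) : ∀ᵐ x ∂F, 0 ≤ x := by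
  rw [ae_iff]
  simpa [Set.Iio] using hF

lemma mem_integrableExpSet_of_le {F : Measure ℝ} (hF : ∀ᵐ x ∂F, 0 ≤ x) {r s : ℝ} (hrs : r ≤ s)
    (hs : s ∈ integrableExpSet id F) : r ∈ integrableExpSet id F := by
  refine Integrable.mono' (g := fun x => Real.exp (s * x)) hs (by fun_prop) ?_
  filter_upwards [hF] with x hx
  rw [Real.norm_eq_abs, Real.abs_exp]
  exact Real.exp_le_exp.2 (mul_le_mul_of_nonneg_right hrs hx)

lemma mem_interior_integrableExpSet_of_lt {F : Measure ℝ} (hF : ∀ᵐ x ∂F, 0 ≤ x) {r s : ℝ}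
    (hrs : r < s) (hs : s ∈ integrableExpSet id F) : r ∈ interior (integrableExpSet id F) :=
  mem_interior.2 ⟨Set.Iio s, fun _ ht => mem_integrableExpSet_of_le hF (le_of_lt ht) hs,
    isOpen_Iio, hrs⟩

lemma mem_integrableExpSet_of_nonpos {F : Measure ℝ} [IsProbabilityMeasure F]
    (hF : ∀ᵐ x ∂F, 0 ≤ x) {r : ℝ} (hr : r ≤ 0) : r ∈ integrableExpSet id F :=
  mem_integrableExpSet_of_le hF hr (by simp [integrableExpSet])

lemma exists_mem_integrableExpSet_of_lt_abscissa {F : Measure ℝ} {r : ℝ}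
    (h : ENNReal.ofReal r < abscissa F) : ∃ s, r < s ∧ s ∈ integrableExpSet id F := by
  rw [abscissa, lt_iSup_iff] at h
  obtain ⟨s, h⟩ := h
  rw [lt_iSup_iff] at h
  obtain ⟨hs, h⟩ := h
  refine ⟨s, ?_, by fun_prop, ?_⟩
  · rw [← ENNReal.ofReal_coe_nnreal] at h
    exact (ENNReal.ofReal_lt_ofReal_iff').1 h |>.1
  · rw [hasFiniteIntegral_iff_norm]
    simpa using hs

lemma integrable_cexp {F : Measure ℝ} {z : ℂ} (hz : z.re ∈ integrableExpSet id F) :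
    Integrable (fun x : ℝ => Complex.exp (z * x)) F := by
  rw [← integrable_norm_iff (by fun_prop)]
  simpa [Complex.norm_exp, integrableExpSet] using hz

/-- For Re z ≤ 0 the integrand e^{zx} has modulus at most 1 on x ≥ 0, so mean 1 forces e^{zx} = 1
almost surely. If z ≠ 0, this places F on a lattice. -/
lemma eq_zero_of_complexMGF_eq_one {F : Measure ℝ} [IsProbabilityMeasure F]
    (hF : ∀ᵐ x ∂F, 0 ≤ x) (hlat : ¬ IsLattice F) {z : ℂ} (hz : z.re ≤ 0)
    (h1 : complexMGF id F z = 1) : z = 0 := by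
  by_contra hne
  apply hlat
  have hint := integrable_cexp (mem_integrableExpSet_of_nonpos hF hz)
  have hre : ∫ x, (1 - (Complex.exp (z * x)).re) ∂F = 0 := by
    rw [integral_sub (integrable_const _) (show Integrable (fun x : ℝ => (Complex.exp (z * x)).re) F
      from hint.re)]
    have : ∫ x, (Complex.exp (z * (x : ℝ))).re ∂F = (complexMGF id F z).re :=
      integral_re hint
    rw [this, h1]
    simp
  have hle : ∀ x : ℝ, 0 ≤ x → ‖Complex.exp (z * x)‖ ≤ 1 := by
    intro x hx
    rw [Complex.norm_exp, Real.exp_le_one_iff]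
    simpa using mul_nonpos_of_nonpos_of_nonneg hz hx
  have hae : ∀ᵐ x : ℝ ∂F, (Complex.exp (z * x)).re = 1 := by
    have h0 : 0 ≤ᵐ[F] fun x : ℝ => 1 - (Complex.exp (z * x)).re := by
      filter_upwards [hF] with x hx
      simpa using (Complex.re_le_norm _).trans (hle x hx)
    have := (integral_eq_zero_iff_of_nonneg_ae h0 ((integrable_const _).sub hint.re)).1 hre
    filter_upwards [this] with x hx
    simp only [Pi.zero_apply] at hx
    linarith
  have hexp : ∀ᵐ x : ℝ ∂F, 0 ≤ x ∧ Complex.exp (z * x) = 1 := by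
    filter_upwards [hae, hF] with x hx h0
    refine ⟨h0, Complex.ext (by simpa using hx) ?_⟩
    have h2 := Complex.sq_norm (Complex.exp (z * x))
    rw [Complex.normSq_apply, hx] at h2
    have h3 := hle x h0
    have h4 := norm_nonneg (Complex.exp (z * x))
    have : (Complex.exp (z * x)).im * (Complex.exp (z * x)).im ≤ 0 := by nlinarith
    simpa using le_antisymm this (mul_self_nonneg _)
  by_cases him : z.im = 0
  -- For real z ≠ 0 the mass sits at 0, and any span will do.
  · refine ⟨1, one_pos, ?_⟩
    rw [← mem_ae_iff]
    filter_upwards [hexp] with x ⟨_, hx⟩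
    have h2 := congrArg norm hx
    rw [Complex.norm_exp, norm_one, Real.exp_eq_one_iff] at h2
    have hzr : z.re ≠ 0 := fun h => hne (Complex.ext h him)
    have : x = 0 := by simpa [hzr] using h2
    exact ⟨0, by simp [this]⟩
  · refine ⟨2 * π / |z.im|, by positivity, ?_⟩
    rw [← mem_ae_iff]
    filter_upwards [hexp] with x ⟨h0, hx⟩
    obtain ⟨n, hn⟩ := Complex.exp_eq_one_iff.1 hx
    have hn' := congrArg Complex.im hn
    simp at hn'
    refine ⟨n.natAbs, ?_⟩
    have h5 : |z.im| * x = n.natAbs * (2 * π) := by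
      have := congrArg abs hn'
      rw [abs_mul, abs_mul, abs_of_nonneg h0, abs_of_pos Real.two_pi_pos] at this
      rw [this, Nat.cast_natAbs, Int.cast_abs]
    have : |z.im| ≠ 0 := abs_ne_zero.2 him
    simp only
    field_simp
    linarith

lemma mgf_lt_one {F : Measure ℝ} [IsProbabilityMeasure F]
    (hF : ∀ᵐ x ∂F, 0 ≤ x) (hlat : ¬ IsLattice F) {r : ℝ} (hr : r < 0) : mgf id F r < 1 := by
  refine lt_of_le_of_ne ?_ fun h => ?_
  · have : ∫ x, Real.exp (r * x) ∂F ≤ ∫ _, (1 : ℝ) ∂F := by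
      refine integral_mono_ae (mem_integrableExpSet_of_nonpos hF hr.le) (integrable_const _) ?_
      filter_upwards [hF] with x hx
      simpa using mul_nonpos_of_nonpos_of_nonneg hr.le hx
    simpa [mgf] using this
  · have := eq_zero_of_complexMGF_eq_one hF hlat (z := r) (by simpa using hr.le)
      (by rw [complexMGF_ofReal, h]; simp)
    exact hr.ne (by exact_mod_cast this)

lemma mean_pos {F : Measure ℝ} [IsProbabilityMeasure F] (hF : ∀ᵐ x ∂F, 0 ≤ x)
    (hlat : ¬ IsLattice F) (hint : Integrable (fun x => x) F) : 0 < mean F := by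
  refine lt_of_le_of_ne (integral_nonneg_of_ae hF) fun h => hlat ?_
  have := (integral_eq_zero_iff_of_nonneg_ae hF hint).1 h.symm
  refine ⟨1, one_pos, ?_⟩
  rw [← mem_ae_iff]
  filter_upwards [this] with x hx
  exact ⟨0, by simpa using hx.symm⟩

/-- For Re z ≤ r, |g'(z)| ≤ ∫ x e^{rx} dF, finite because r < s; the mean value inequality applies
on the convex half-plane. -/
lemma exists_lipschitz_complexMGF {F : Measure ℝ} (hF : ∀ᵐ x ∂F, 0 ≤ x) {r s : ℝ} (hrs : r < s)
    (hs : s ∈ integrableExpSet id F) :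
    ∃ K : ℝ, 0 < K ∧ ∀ z w : ℂ, z.re ≤ r → w.re ≤ r →
      ‖complexMGF id F z - complexMGF id F w‖ ≤ K * ‖z - w‖ := by
  set K := ∫ x, x * Real.exp (r * x) ∂F
  have hmem : ∀ z : ℂ, z.re ≤ r → z.re ∈ interior (integrableExpSet id F) := fun z hz =>
    mem_interior_integrableExpSet_of_lt hF (hz.trans_lt hrs) hs
  have hint : Integrable (fun x => x * Real.exp (r * x)) F := by
    simpa using integrable_pow_mul_exp_of_mem_interior_integrableExpSet
      (mem_interior_integrableExpSet_of_lt hF hrs hs) 1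
  have hderiv : ∀ z : ℂ, z.re ≤ r → ‖∫ x, (id x : ℝ) * Complex.exp (z * (id x : ℝ)) ∂F‖ ≤ K := by
    intro z hz
    refine norm_integral_le_of_norm_le hint ?_
    filter_upwards [hF] with x hx
    simp only [id, norm_mul, Complex.norm_real, Complex.norm_exp, Real.norm_eq_abs, abs_of_nonneg hx]
    gcongr
    simp
    gcongr
  have hK : 0 ≤ K := integral_nonneg_of_ae (by filter_upwards [hF] with x hx; positivity)
  refine ⟨K + 1, by positivity, fun z w hz hw => ?_⟩
  have hconv : Convex ℝ {z : ℂ | z.re ≤ r} := convex_halfSpace_re_le r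
  refine (hconv.norm_image_sub_le_of_norm_hasDerivWithin_le
    (fun y hy => (hasDerivAt_complexMGF (hmem y hy)).hasDerivWithinAt) hderiv hw hz).trans ?_
  gcongr
  linarith

/-! ### The renewal function -/

instance instIsProbabilityMeasureConvPow (F : Measure ℝ) [IsProbabilityMeasure F] (n : ℕ) :
    IsProbabilityMeasure (convPow F n) := by
  induction n with
  | zero => rw [convPow]; infer_instance
  | succ n ih => rw [convPow]; infer_instance

lemma convPow_nonneg {F : Measure ℝ} [IsProbabilityMeasure F] (hF : ∀ᵐ x ∂F, 0 ≤ x) (n : ℕ) :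
    ∀ᵐ x ∂(convPow F n), 0 ≤ x := by
  induction n with
  | zero => simp [convPow, ae_dirac_eq]
  | succ n ih =>
    rw [convPow, Measure.conv, ae_map_iff (by fun_prop) measurableSet_Ici]
    filter_upwards [Measure.quasiMeasurePreserving_fst.ae ih,
      Measure.quasiMeasurePreserving_snd.ae hF] with x h1 h2
    exact add_nonneg h1 h2

lemma complexMGF_convPow (F : Measure ℝ) [IsProbabilityMeasure F] (n : ℕ) (z : ℂ) :
    complexMGF id (convPow F n) z = complexMGF id F z ^ n := by
  induction n with
  | zero => simp [convPow, complexMGF]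
  | succ n ih =>
    rw [pow_succ, ← ih]
    simp only [complexMGF, convPow, Measure.conv]
    rw [integral_map (by fun_prop) (by fun_prop), ← integral_prod_mul]
    simp [mul_add, Complex.exp_add]

lemma mgf_convPow (F : Measure ℝ) [IsProbabilityMeasure F] (n : ℕ) (r : ℝ) :
    mgf id (convPow F n) r = mgf id F r ^ n := by
  have := complexMGF_convPow F n r
  rw [complexMGF_ofReal, complexMGF_ofReal] at this
  exact_mod_cast this

lemma measureReal_Iic_le {ν : Measure ℝ} [IsProbabilityMeasure ν] (hν : ∀ᵐ x ∂ν, 0 ≤ x)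
    {r : ℝ} (hr : r ≤ 0) (x : ℝ) : ν.real (Set.Iic x) ≤ Real.exp (-r * x) * mgf id ν r := by
  simpa [Set.Iic] using measure_le_le_exp_mul_mgf (X := id) x hr (mem_integrableExpSet_of_nonpos hν hr)

/-- Chernoff's bound at exponent -1 gives geometric decay in n, as g(-1) < 1. So U is finite and
passing to real values loses nothing. -/
lemma summable_convPow_Iic {F : Measure ℝ} [IsProbabilityMeasure F]
    (hF : ∀ᵐ x ∂F, 0 ≤ x) (hlat : ¬ IsLattice F) (x : ℝ) :
    Summable fun n => (convPow F n).real (Set.Iic x) := by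
  have h1 := mgf_lt_one hF hlat (r := -1) (by norm_num)
  refine Summable.of_nonneg_of_le (fun n => measureReal_nonneg)
    (fun n => measureReal_Iic_le (convPow_nonneg hF n) (r := -1) (by norm_num) x) ?_
  simp_rw [mgf_convPow]
  exact (summable_geometric_of_lt_one mgf_nonneg h1).mul_left _

lemma renewalFunction_toReal (F : Measure ℝ) [IsProbabilityMeasure F] (x : ℝ) :
    (renewalFunction F x).toReal = ∑' n, (convPow F n).real (Set.Iic x) := by
  rw [renewalFunction, ENNReal.tsum_toReal_eq fun n => measure_ne_top _ _]
  rfl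

lemma monotone_renewalFunction_toReal {F : Measure ℝ} [IsProbabilityMeasure F]
    (hF : ∀ᵐ x ∂F, 0 ≤ x) (hlat : ¬ IsLattice F) :
    Monotone fun x => (renewalFunction F x).toReal := by
  intro x y hxy
  simp only [renewalFunction_toReal]
  exact (summable_convPow_Iic hF hlat x).tsum_le_tsum
    (fun n => measureReal_mono (Set.Iic_subset_Iic.2 hxy)) (summable_convPow_Iic hF hlat y)

lemma integrableOn_cexp_Ioi {z : ℂ} (hz : z.re < 0) (a : ℝ) :
    IntegrableOn (fun x : ℝ => Complex.exp (z * x)) (Set.Ioi a) :=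
  integrableOn_exp_mul_complex_Ioi hz a

/-- Write the distribution function as ∫ 1_{s ≤ x} dν(s) and exchange integrals; the inner one is
∫_s^∞ e^{zx} dx = -e^{zs}/z. -/
lemma laplace_cdf_aux {ν : Measure ℝ} [IsProbabilityMeasure ν] (hν : ∀ᵐ x ∂ν, 0 ≤ x) {z : ℂ}
    (hz : z.re < 0) :
    Integrable (fun x : ℝ => Complex.exp (z * x) * (ν.real (Set.Iic x) : ℂ))
      (volume.restrict (Set.Ioi 0)) ∧
    ∫ x in Set.Ioi (0 : ℝ), Complex.exp (z * x) * (ν.real (Set.Iic x) : ℂ)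
      = -(complexMGF id ν z / z) := by
  have hint : Integrable (Function.uncurry fun (x s : ℝ) =>
      (Set.Ici s).indicator (fun x : ℝ => Complex.exp (z * x)) x)
      ((volume.restrict (Set.Ioi 0)).prod ν) := by
    have h1 : Integrable (fun p : ℝ × ℝ => Complex.exp (z * p.1))
        ((volume.restrict (Set.Ioi 0)).prod ν) :=
      (show Integrable (fun x : ℝ => Complex.exp (z * x)) (volume.restrict (Set.Ioi 0)) from
        integrableOn_cexp_Ioi hz 0).comp_fst ν
    have h2 := h1.indicator (measurableSet_le (measurable_snd (α := ℝ) (β := ℝ)) measurable_fst)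
    refine h2.congr (Eventually.of_forall fun p => ?_)
    simp [Function.uncurry, Set.indicator_apply]
  have hin : ∀ x : ℝ, ∫ s, (Set.Ici s).indicator (fun x : ℝ => Complex.exp (z * x)) x ∂ν
      = Complex.exp (z * x) * (ν.real (Set.Iic x) : ℂ) := by
    intro x
    have : (fun s => (Set.Ici s).indicator (fun x : ℝ => Complex.exp (z * x)) x) =
        (Set.Iic x).indicator (fun _ => Complex.exp (z * x)) := by
      ext s; simp [Set.indicator_apply]
    rw [this, integral_indicator measurableSet_Iic, setIntegral_const, Complex.real_smul, mul_comm]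
  refine ⟨?_, ?_⟩
  · simpa only [Function.uncurry, hin] using hint.integral_prod_left
  · simp_rw [← hin]
    rw [integral_integral_swap hint, complexMGF, ← integral_div, ← integral_neg]
    refine integral_congr_ae ?_
    filter_upwards [hν] with s hs
    rw [integral_indicator measurableSet_Ici, Measure.restrict_restrict measurableSet_Ici,
      setIntegral_congr_set (t := Set.Ioi s), integral_exp_mul_complex_Ioi hz, id]
    · ring
    · rw [Set.inter_comm]
      have : (Set.Ioi (0 : ℝ) ∩ Set.Ici s : Set ℝ) =ᵐ[volume] (Set.Ici (0:ℝ) ∩ Set.Ici s : Set ℝ) :=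
        Ioi_ae_eq_Ici.inter (ae_eq_refl _)
      rw [Set.Ici_inter_Ici, max_eq_right hs] at this
      exact this.trans Ioi_ae_eq_Ici.symm

lemma laplace_renewalFunction {F : Measure ℝ} [IsProbabilityMeasure F]
    (hF : ∀ᵐ x ∂F, 0 ≤ x) (hlat : ¬ IsLattice F) {z : ℂ} (hz : z.re < 0) :
    ∫ x in Set.Ioi (0 : ℝ), Complex.exp (z * x) * ((renewalFunction F x).toReal : ℂ)
      = -(1 / (z * (1 - complexMGF id F z))) := by
  have hlt := mgf_lt_one hF hlat hz
  -- The modulus of the n-th term is the same term at the real point Re z, so its integral is known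
  -- exactly and is geometric in n.
  have hnorm : ∀ n, ∫ x in Set.Ioi (0 : ℝ),
      ‖Complex.exp (z * x) * ((convPow F n).real (Set.Iic x) : ℂ)‖ = -(mgf id F z.re ^ n / z.re) := by
    intro n
    have h1 := (laplace_cdf_aux (convPow_nonneg hF n) (z := z.re) (by simpa)).2
    rw [complexMGF_ofReal, mgf_convPow] at h1
    have h2 : ∀ x : ℝ, Complex.exp ((z.re : ℂ) * x) * ((convPow F n).real (Set.Iic x) : ℂ)
        = ((‖Complex.exp (z * x) * ((convPow F n).real (Set.Iic x) : ℂ)‖ : ℝ) : ℂ) := by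
      intro x
      simp [Complex.norm_exp, abs_of_nonneg measureReal_nonneg]
    rw [integral_congr_ae (Eventually.of_forall h2), integral_complex_ofReal] at h1
    exact_mod_cast h1
  have h := hasSum_integral_of_summable_integral_norm (μ := volume.restrict (Set.Ioi (0:ℝ)))
    (fun n => (laplace_cdf_aux (convPow_nonneg hF n) hz).1) (by
      simp_rw [hnorm]
      exact ((summable_geometric_of_lt_one mgf_nonneg hlt).div_const _).neg)
  simp_rw [(laplace_cdf_aux (convPow_nonneg hF _) hz).2, complexMGF_convPow] at h
  have hgeo : HasSum (fun n => -(complexMGF id F z ^ n / z))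
      (-((1 - complexMGF id F z)⁻¹ / z)) :=
    ((hasSum_geometric_of_norm_lt_one
      (norm_complexMGF_le_mgf.trans_lt hlt)).div_const z).neg
  have := h.unique hgeo
  rw [one_div, mul_inv_rev, ← div_eq_mul_inv, ← this]
  refine integral_congr_ae (Eventually.of_forall fun x => ?_)
  simp only
  rw [renewalFunction_toReal, Complex.ofReal_tsum, tsum_mul_left]

lemma integrable_cexp_mul_renewalFunction {F : Measure ℝ} [IsProbabilityMeasure F]
    (hF : ∀ᵐ x ∂F, 0 ≤ x) (hlat : ¬ IsLattice F) {z : ℂ} (hz : z.re < 0) :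
    IntegrableOn (fun x : ℝ => Complex.exp (z * x) * ((renewalFunction F x).toReal : ℂ))
      (Set.Ioi 0) := by
  have hm : Measurable fun x => (renewalFunction F x).toReal :=
    (monotone_renewalFunction_toReal hF hlat).measurable
  have h1 : Integrable (fun x : ℝ => Complex.exp ((z.re : ℂ) * x) *
      ((renewalFunction F x).toReal : ℂ)) (volume.restrict (Set.Ioi 0)) := by
    -- A non-integrable function has integral 0 by convention, whereas this integral has been
    -- computed and is nonzero.
    refine not_imp_comm.1 integral_undef ?_
    rw [laplace_renewalFunction hF hlat (by simpa using hz), complexMGF_ofReal]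
    have hlt := mgf_lt_one hF hlat hz
    have h2 : (1 : ℂ) - (mgf id F z.re : ℂ) ≠ 0 := by
      rw [sub_ne_zero]; exact_mod_cast hlt.ne'
    have h3 : (z.re : ℂ) ≠ 0 := by exact_mod_cast hz.ne
    simp [h2, h3]
  refine h1.mono ?_ (Eventually.of_forall fun x => ?_)
  · exact (Measurable.aestronglyMeasurable (by fun_prop))
  · simp [Complex.norm_exp]

/-! ### The zeros of `1 - g` -/

lemma exists_bound_of_uniformlyStronglyNonlattice {F : Measure ℝ} {R₀ : ℝ}
    (hA : UniformlyStronglyNonlattice F R₀) :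
    ∃ b > 0, ∃ T : ℝ, ∀ z : ℂ, 0 ≤ z.re → z.re ≤ R₀ → T ≤ |z.im| →
      b ≤ ‖1 - complexMGF id F z‖ := by
  obtain ⟨C, hC, hCtop⟩ := exists_between (show _ < (∞ : ℝ≥0∞) from hA)
  have hev := eventually_sup.1 (eventually_lt_of_limsup_lt hC)
  obtain ⟨u, hu⟩ := eventually_atBot.1 hev.1
  obtain ⟨v, hv⟩ := eventually_atTop.1 hev.2
  refine ⟨C⁻¹.toReal, ENNReal.toReal_pos (by simpa using hCtop.ne) ?_, max |u| |v|,
    fun z h0 h1 hT => ?_⟩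
  · simpa using (bot_le.trans_lt hC).ne'
  have hz : (⨆ r ∈ Set.Icc (0 : ℝ) R₀,
      ‖1 - complexMGF id F ((r : ℂ) + Complex.I * (z.im : ℂ))‖ₑ⁻¹) < C := by
    rcases le_total 0 z.im with h | h
    · rw [abs_of_nonneg h] at hT
      exact hv _ ((le_abs_self v).trans ((le_max_right _ _).trans hT))
    · rw [abs_of_nonpos h] at hT
      refine hu _ ?_
      have := (neg_le_abs u).trans ((le_max_left _ |v|).trans hT)
      linarith
  have h2 : ‖1 - complexMGF id F z‖ₑ⁻¹ ≤ C := by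
    refine le_trans ?_ hz.le
    have h3 := le_iSup₂ (f := fun (r : ℝ) (_ : r ∈ Set.Icc (0 : ℝ) R₀) =>
      ‖1 - complexMGF id F ((r : ℂ) + Complex.I * (z.im : ℂ))‖ₑ⁻¹) z.re ⟨h0, h1⟩
    simpa only [mul_comm Complex.I, Complex.re_add_im] using h3
  rw [ENNReal.inv_le_iff_inv_le] at h2
  rw [← toReal_enorm]
  exact ENNReal.toReal_mono enorm_ne_top h2

/-- The lower bound for `1 - g` extends to a slightly wider strip. -/
lemma exists_bound_wider_strip {F : Measure ℝ} (hF : ∀ᵐ x ∂F, 0 ≤ x) {R₀ R₁ : ℝ} (h0 : 0 < R₀)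
    (h01 : R₀ < R₁) (hR₁ : R₁ ∈ integrableExpSet id F) (hA : UniformlyStronglyNonlattice F R₀) :
    ∃ ε > 0, R₀ + ε < R₁ ∧ ∃ b > 0, ∃ T : ℝ, ∀ z : ℂ, -ε ≤ z.re → z.re ≤ R₀ + ε → T ≤ |z.im| →
      b ≤ ‖1 - complexMGF id F z‖ := by
  obtain ⟨b, hb, T, h⟩ := exists_bound_of_uniformlyStronglyNonlattice hA
  -- With ε ≤ b/(2K), moving a distance ε changes g by at most b/2, leaving half of the lower bound.
  -- The other term of the minimum keeps the strip inside the half-plane where g is Lipschitz.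
  obtain ⟨K, hK, hlip⟩ := exists_lipschitz_complexMGF hF (r := (R₀ + R₁) / 2) (by linarith) hR₁
  have hε1 : min ((R₁ - R₀) / 2) (b / (2 * K)) ≤ (R₁ - R₀) / 2 := min_le_left _ _
  have hε2 : min ((R₁ - R₀) / 2) (b / (2 * K)) ≤ b / (2 * K) := min_le_right _ _
  have hε0 : 0 < min ((R₁ - R₀) / 2) (b / (2 * K)) :=
    lt_min (by linarith) (by positivity)
  set ε := min ((R₁ - R₀) / 2) (b / (2 * K))
  refine ⟨ε, hε0, by linarith, b / 2, by positivity, T, fun z hz1 hz2 hT => ?_⟩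
  -- Projection of Re z onto [0, R₀]: `w` below is the nearest point of the original strip at the
  -- same height.
  set t := max 0 (min R₀ z.re) with ht
  have ht0 : 0 ≤ t := le_max_left _ _
  have htR : t ≤ R₀ := max_le h0.le (min_le_left _ _)
  have htz : |z.re - t| ≤ ε := by
    rw [ht]
    rcases le_total R₀ z.re with h1 | h1
    · rw [min_eq_left h1, max_eq_right h0.le, abs_of_nonneg (by linarith)]
      linarith
    · rw [min_eq_right h1]
      rcases le_total 0 z.re with h2 | h2
      · rw [max_eq_right h2]; simpa using hε0.le
      · rw [max_eq_left h2, sub_zero, abs_of_nonpos h2]; linarith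
  set w : ℂ := t + z.im * Complex.I with hw
  have hzw : ‖z - w‖ ≤ ε := by
    have : z - w = ((z.re - t : ℝ) : ℂ) := Complex.ext (by simp [hw]) (by simp [hw])
    rw [this, Complex.norm_real]
    exact htz
  have h1 := h w (by simpa [hw]) (by simpa [hw]) (by simpa [hw])
  have h2 := hlip z w (by linarith) (by simp [hw]; linarith)
  have h3 : K * ‖z - w‖ ≤ b / 2 := by
    calc K * ‖z - w‖ ≤ K * (b / (2 * K)) := by gcongr; exact hzw.trans hε2
      _ = b / 2 := by field_simp
  have h4 : ‖1 - complexMGF id F w‖ ≤ ‖1 - complexMGF id F z‖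
      + ‖complexMGF id F z - complexMGF id F w‖ := by
    refine le_trans (le_of_eq ?_) (norm_add_le _ _)
    congr 1
    ring
  linarith

/-- Zeros have Re z ≥ 0 by non-latticeness and |Im z| < T by hypothesis, so they lie in a compact
rectangle. They are isolated, since g(-1) < 1 rules out g = 1 identically. -/
lemma finite_complexMGF_eq_one {F : Measure ℝ} [IsProbabilityMeasure F] (hF : ∀ᵐ x ∂F, 0 ≤ x)
    (hlat : ¬ IsLattice F) {r R₁ T : ℝ} (hr : r < R₁) (h1 : 0 < R₁)
    (hR₁ : R₁ ∈ integrableExpSet id F)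
    (hT : ∀ z : ℂ, 0 ≤ z.re → z.re ≤ r → T ≤ |z.im| → complexMGF id F z ≠ 1) :
    {z : ℂ | z.re ≤ r ∧ complexMGF id F z = 1}.Finite := by
  set D : Set ℂ := {z | z.re < R₁}
  have han : AnalyticOnNhd ℂ (fun z => complexMGF id F z - 1) D := fun z hz =>
    (analyticAt_complexMGF (mem_interior_integrableExpSet_of_lt hF hz hR₁)).sub analyticAt_const
  have hD : IsPreconnected D := (convex_halfSpace_re_lt R₁).isPreconnected
  set K : Set ℂ := Set.Icc 0 r ×ℂ Set.Icc (-T) T with hK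
  have hKc : IsCompact K := isCompact_Icc.reProdIm isCompact_Icc
  have hKD : K ⊆ D := fun z hz => ((Complex.mem_reProdIm.1 hz).1.2).trans_lt hr
  rcases han.eqOn_zero_or_eventually_ne_zero_of_preconnected hD with h | h
  · exfalso
    have h2 := h (show ((-1 : ℝ) : ℂ) ∈ D by simp [D]; linarith)
    simp only [complexMGF_ofReal, Pi.zero_apply, sub_eq_zero] at h2
    have := mgf_lt_one hF hlat (r := -1) (by norm_num)
    exact this.ne (by exact_mod_cast h2)
  · refine (hKc.finite_sdiff_of_mem_codiscreteWithin
      (codiscreteWithin_mono hKD h)).subset ?_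
    rintro z ⟨hzr, hz⟩
    have hz0 : 0 ≤ z.re := by
      by_contra hneg
      have := eq_zero_of_complexMGF_eq_one hF hlat (not_le.1 hneg).le hz
      simp [this] at hneg
    refine ⟨Complex.mem_reProdIm.2 ⟨⟨hz0, hzr⟩, ?_⟩, by simp [hz]⟩
    rw [Set.mem_Icc, ← abs_le]
    by_contra hcon
    exact hT z hz0 hzr (not_le.1 hcon).le hz

/-! ### Residues of `exp (-x z) / (z (1 - g z))` -/

lemma meromorphicAt_laplace {g : ℂ → ℂ} {ζ : ℂ} (hg : AnalyticAt ℂ g ζ) :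
    MeromorphicAt (fun z => 1 / (z * (1 - g z))) ζ :=
  (analyticAt_const.meromorphicAt).div
    (analyticAt_id.mul (analyticAt_const.sub hg)).meromorphicAt

lemma hasResidue_of_simple_zero {g : ℂ → ℂ} {ζ : ℂ} (hg : AnalyticAt ℂ g ζ) (hζ : ζ ≠ 0)
    (h1 : g ζ = 1) (hd : deriv g ζ ≠ 0) (x : ℂ) :
    HasResidue (fun z => Complex.exp (-x * z) / (z * (1 - g z))) ζ
      (-(Complex.exp (-x * ζ) / (ζ * deriv g ζ))) := by
  have han : AnalyticAt ℂ (fun z => -(Complex.exp (-x * z) / (z * dslope g ζ z))) ζ := by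
    refine (AnalyticAt.div (by fun_prop) (analyticAt_id.mul (analyticAt_dslope hg)) ?_).neg
    simpa [dslope_same] using ⟨hζ, hd⟩
  have h := hasResidue_inv_pow_mul han 0
  simp only [Nat.factorial_zero, Nat.cast_one, inv_one, one_mul, iteratedDeriv_zero,
    dslope_same] at h
  refine h.congr ?_
  filter_upwards [self_mem_nhdsWithin] with z hz
  rw [eq_add_mul_dslope g ζ z, h1, zero_add, pow_one, sub_add_cancel_left, mul_neg,
    div_neg, mul_neg, mul_left_comm, mul_comm (z - ζ)⁻¹, ← div_eq_mul_inv, div_div]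
  ring_nf

/-- With d the slope quotient of g at 0, the function is -z^{-2} e^{-xz}/d(z); the residue at this
double pole is the derivative of -e^{-xz}/d(z) at 0. -/
lemma hasResidue_zero_of_deriv_ne_zero {g : ℂ → ℂ} (hg : AnalyticAt ℂ g 0) (h1 : g 0 = 1)
    (hd : deriv g 0 ≠ 0) (x : ℂ) :
    HasResidue (fun z => Complex.exp (-x * z) / (z * (1 - g z))) 0
      (x / deriv g 0 + iteratedDeriv 2 g 0 / (2 * deriv g 0 ^ 2)) := by
  have hds := analyticAt_dslope hg
  have hne : dslope g 0 0 ≠ 0 := by simpa [dslope_same] using hd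
  have han : AnalyticAt ℂ (fun z => -(Complex.exp (-x * z) / dslope g 0 z)) 0 :=
    (AnalyticAt.div (by fun_prop) hds hne).neg
  have h := hasResidue_inv_pow_mul han 1
  have hexp : HasDerivAt (fun z => Complex.exp (-x * z)) (-x) 0 := by
    have := ((hasDerivAt_id (0 : ℂ)).const_mul (-x)).cexp
    simpa using this
  have hder := ((hexp.div hds.differentiableAt.hasDerivAt hne).neg).deriv
  have hval : ((Nat.factorial 1 : ℕ) : ℂ)⁻¹ *
      iteratedDeriv 1 (fun z => -(Complex.exp (-x * z) / dslope g 0 z)) 0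
      = x / deriv g 0 + iteratedDeriv 2 g 0 / (2 * deriv g 0 ^ 2) := by
    rw [iteratedDeriv_one]
    have h2 : deriv (fun z => -(Complex.exp (-x * z) / dslope g 0 z)) 0 = _ := hder
    rw [h2, deriv_dslope_self hg, dslope_same]
    simp
    field_simp
    ring
  rw [hval] at h
  refine h.congr ?_
  filter_upwards [self_mem_nhdsWithin] with z hz
  have hz' : z ≠ 0 := hz
  rw [eq_add_mul_dslope g 0 z, h1, sub_add_cancel_left, sub_zero, inv_pow, mul_neg, mul_neg,
    div_neg, inv_mul_eq_div, div_div]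
  ring_nf

lemma complexMGF_zero_eq_one (F : Measure ℝ) [IsProbabilityMeasure F] : complexMGF id F 0 = 1 := by
  simp [complexMGF]

lemma residue_zero_renewal {F : Measure ℝ} [IsProbabilityMeasure F] (hF : ∀ᵐ x ∂F, 0 ≤ x)
    (hlat : ¬ IsLattice F) {R₁ : ℝ} (h1 : 0 < R₁) (hR₁ : R₁ ∈ integrableExpSet id F) (x : ℝ) :
    residue (fun z => Complex.exp (-(x : ℂ) * z) / (z * (1 - complexMGF id F z))) 0
      = ((x / mean F + secondMoment F / (2 * mean F ^ 2) : ℝ) : ℂ) := by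
  have hmem : (0 : ℂ).re ∈ interior (integrableExpSet id F) :=
    mem_interior_integrableExpSet_of_lt hF (by simpa) hR₁
  have hd : deriv (complexMGF id F) 0 = (mean F : ℂ) := by
    rw [(hasDerivAt_complexMGF hmem).deriv, mean, ← integral_complex_ofReal]
    simp
  have hd2 : iteratedDeriv 2 (complexMGF id F) 0 = (secondMoment F : ℂ) := by
    rw [iteratedDeriv_complexMGF hmem, secondMoment, ← integral_complex_ofReal]
    simp
  have hint : Integrable (fun x => x) F := by
    simpa using integrable_pow_of_mem_interior_integrableExpSet (X := id) (μ := F)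
      (by simpa using hmem) 1
  have hm : (mean F : ℂ) ≠ 0 := by exact_mod_cast (mean_pos hF hlat hint).ne'
  rw [(hasResidue_zero_of_deriv_ne_zero (analyticAt_complexMGF hmem) (complexMGF_zero_eq_one F)
    (by rwa [hd]) x).residue_eq, hd, hd2]
  push_cast
  rfl

/-! ### Box averages through Laplace inversion -/

/-- The transform of the uniform distribution on `[-η, 0]`. -/
noncomputable def boxKernel (η : ℝ) (z : ℂ) : ℂ :=
  -(1 / (η : ℂ)) * dslope (fun z : ℂ => Complex.exp (-(η : ℂ) * z)) 0 z

lemma boxKernel_of_ne_zero (η : ℝ) {z : ℂ} (hz : z ≠ 0) :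
    boxKernel η z = (1 - Complex.exp (-(η : ℂ) * z)) / (η * z) := by
  rw [boxKernel, dslope_of_ne _ hz, slope_def_field, mul_zero, Complex.exp_zero, sub_zero,
    ← neg_sub (1 : ℂ), neg_div, neg_mul_neg, one_div, inv_mul_eq_div, div_div, mul_comm z]

lemma differentiable_boxKernel (η : ℝ) : Differentiable ℂ (boxKernel η) := by
  have h : DifferentiableOn ℂ (dslope (fun z : ℂ => Complex.exp (-(η : ℂ) * z)) 0) Set.univ :=
    (Complex.differentiableOn_dslope univ_mem).2 (by fun_prop)
  exact (differentiableOn_univ.1 h).const_mul _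

/-- Interpolates between the bound 2 for η|z| ≤ 1 and 2/(η|z|) otherwise. A small δ already makes
the inversion integral converge, at the low price η^{-δ}. -/
lemma norm_boxKernel_le_rpow {η : ℝ} (hη : 0 < η) {z : ℂ} (hz : 0 < z.re) {δ : ℝ} (hδ : 0 < δ)
    (hδ1 : δ ≤ 1) : ‖boxKernel η z‖ ≤ 2 * (η ^ (-δ) * ‖z‖ ^ (-δ)) := by
  have hz0 : z ≠ 0 := by rintro rfl; simp at hz
  have hzn : 0 < ‖z‖ := norm_pos_iff.2 hz0
  rw [← Real.mul_rpow hη.le hzn.le, boxKernel_of_ne_zero η hz0, norm_div, norm_mul,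
    Complex.norm_real, Real.norm_of_nonneg hη.le]
  have hp : 0 < η * ‖z‖ := by positivity
  have hnorm : ‖-(η : ℂ) * z‖ = η * ‖z‖ := by simp [abs_of_pos hη]
  rw [div_le_iff₀ hp]
  rcases le_total (η * ‖z‖) 1 with h | h
  · have h1 := Complex.norm_exp_sub_one_le (x := -(η : ℂ) * z) (by rwa [hnorm])
    rw [hnorm, norm_sub_rev] at h1
    have h2 : (1 : ℝ) ≤ (η * ‖z‖) ^ (-δ) := Real.one_le_rpow_of_pos_of_le_one_of_nonpos hp h
      (by linarith)
    nlinarith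
  · have h1 : ‖1 - Complex.exp (-(η : ℂ) * z)‖ ≤ 2 := by
      refine (norm_sub_le _ _).trans ?_
      rw [norm_one, Complex.norm_exp]
      have : Real.exp (-(η : ℂ) * z).re ≤ 1 := by
        rw [Real.exp_le_one_iff]
        simp only [Complex.mul_re, Complex.neg_re, Complex.ofReal_re, Complex.neg_im,
          Complex.ofReal_im, neg_zero, zero_mul, sub_zero]
        nlinarith
      linarith
    have h2 : (η * ‖z‖) ^ (-1 : ℝ) ≤ (η * ‖z‖) ^ (-δ) :=
      Real.rpow_le_rpow_of_exponent_le h (by linarith)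
    rw [Real.rpow_neg_one] at h2
    calc ‖1 - Complex.exp (-(η : ℂ) * z)‖ ≤ 2 := h1
      _ = 2 * (η * ‖z‖)⁻¹ * (η * ‖z‖) := by field_simp
      _ ≤ _ := by gcongr

lemma exists_bound_div_one_add_abs_im {f : ℂ → ℂ} {a b A T : ℝ} (hT : 1 ≤ T)
    (hf : ContinuousOn f {z | a ≤ z.re ∧ z.re ≤ b})
    (hA : ∀ z : ℂ, a ≤ z.re → z.re ≤ b → T ≤ |z.im| → ‖f z‖ ≤ A / |z.im|) :
    ∃ B, 0 ≤ B ∧ ∀ z : ℂ, a ≤ z.re → z.re ≤ b → ‖f z‖ ≤ B / (1 + |z.im|) := by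
  have hK : IsCompact (Set.Icc a b ×ℂ Set.Icc (-T) T) := isCompact_Icc.reProdIm isCompact_Icc
  obtain ⟨M, hM⟩ := hK.exists_bound_of_continuousOn
    (hf.mono fun z hz => (Complex.mem_reProdIm.1 hz).1)
  refine ⟨max (|M| * (1 + T)) (2 * |A|), by positivity, fun z h1 h2 => ?_⟩
  rw [le_div_iff₀ (by positivity)]
  rcases le_total |z.im| T with h | h
  · refine le_trans ?_ (le_max_left _ _)
    have := hM z (Complex.mem_reProdIm.2 ⟨⟨h1, h2⟩, abs_le.1 h⟩)
    gcongr
    exact this.trans (le_abs_self M)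
  · refine le_trans ?_ (le_max_right _ _)
    have hpos : 0 < |z.im| := by linarith
    have h3 := hA z h1 h2 h
    rw [le_div_iff₀ hpos] at h3
    nlinarith [norm_nonneg (f z), le_abs_self A]

/-- Laplace inversion for the average of `w` over `[x, x + η]`. -/
lemma integral_box_eq {w : ℝ → ℂ} {Φ : ℂ → ℂ} {c η : ℝ} (hc : 0 < c) (hη : 0 < η)
    (hw : Integrable fun x : ℝ => Complex.exp (-(c : ℂ) * x) * w x)
    (hΦ : ∀ y : ℝ, ∫ x : ℝ, Complex.exp (((-c : ℝ) + y * Complex.I) * x) * w x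
      = Φ ((-c : ℝ) + y * Complex.I))
    (hint : Integrable fun y : ℝ =>
      boxKernel η ((-c : ℝ) + y * Complex.I) * Φ ((-c : ℝ) + y * Complex.I)) (x : ℝ) :
    (1 / (η : ℂ)) * ∫ u in x..(x + η), w u = (1 / (2 * π : ℝ) : ℝ) •
      ∫ y : ℝ, Complex.exp (-(x : ℂ) * ((-c : ℝ) + y * Complex.I)) *
        (boxKernel η ((-c : ℝ) + y * Complex.I) * Φ ((-c : ℝ) + y * Complex.I)) := by
  set p : ℝ → ℂ := fun x => Complex.exp (-(c : ℂ) * x) * w x with hp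
  set κ : ℝ → ℂ := (Set.Ioc (-η) 0).indicator
    fun t => (1 / (η : ℂ)) * Complex.exp (-(c : ℂ) * t) with hκ
  have hκint : Integrable κ := by
    rw [hκ, integrable_indicator_iff measurableSet_Ioc]
    exact (Continuous.integrableOn_Icc (by fun_prop)).mono_set Set.Ioc_subset_Icc_self
  have hwint : ∀ a b : ℝ, IntervalIntegrable (fun u : ℝ => w u) volume a b := by
    intro a b
    have h1 : IntervalIntegrable p volume a b := hw.intervalIntegrable
    have h2 := h1.continuousOn_mul (g := fun u : ℝ => Complex.exp ((c : ℂ) * u)) (by fun_prop)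
    refine h2.congr fun u _ => ?_
    simp only [hp]
    rw [← mul_assoc, ← Complex.exp_add]
    simp
  -- This convolution is e^{-cx} times the average of `w` over [x, x + η]. The tilt by e^{-cx} turns
  -- the transform on Re z = -c into a Fourier transform, with y = -2πξ.
  set f : ℝ → ℂ := MeasureTheory.convolution κ p (ContinuousLinearMap.mul ℂ ℂ) volume with hf
  have hfx : ∀ x : ℝ, f x =
      Complex.exp (-(c : ℂ) * x) * ((1 / (η : ℂ)) * ∫ u in x..(x + η), w u) := by
    intro x
    rw [hf, convolution_def]
    have h1 : (fun t => (ContinuousLinearMap.mul ℂ ℂ) (κ t) (p (x - t))) =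
        (Set.Ioc (-η) 0).indicator fun t => (Complex.exp (-(c : ℂ) * x) * (1 / (η : ℂ))) *
          w (x - t) := by
      ext t
      simp only [hκ, hp, ContinuousLinearMap.mul_apply', Set.indicator_apply]
      split_ifs
      · have : Complex.exp (-(c : ℂ) * x) = Complex.exp (-(c : ℂ) * t) *
            Complex.exp (-(c : ℂ) * ((x - t : ℝ) : ℂ)) := by
          rw [← Complex.exp_add]; congr 1; push_cast; ring
        rw [this]; ring
      · simp
    rw [h1, integral_indicator measurableSet_Ioc, integral_const_mul,
      ← intervalIntegral.integral_of_le (by linarith),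
      intervalIntegral.integral_comp_sub_left (fun u : ℝ => w u), sub_zero, sub_neg_eq_add, mul_assoc]
  -- Continuity, from primitives of `w`, makes Fourier inversion valid at every x and not merely
  -- almost everywhere.
  have hfc : Continuous f := by
    have h1 : f = fun x : ℝ => Complex.exp (-(c : ℂ) * x) *
        ((1 / (η : ℂ)) * ((∫ u in (0 : ℝ)..(x + η), w u) - ∫ u in (0 : ℝ)..x, w u)) := by
      ext x
      rw [hfx, intervalIntegral.integral_interval_sub_left (hwint _ _) (hwint _ _)]
    have h2 := intervalIntegral.continuous_primitive hwint 0
    rw [h1]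
    exact Continuous.mul (by fun_prop) (continuous_const.mul
      ((h2.comp (continuous_id.add continuous_const)).sub h2))
  have hfint : Integrable f := hκint.integrable_convolution _ hw
  have hFp : ∀ ξ : ℝ, FourierTransform.fourier p ξ
      = Φ ((-c : ℝ) + ((-2 * π * ξ : ℝ) : ℂ) * Complex.I) := by
    intro ξ
    rw [Real.fourier_real_eq_integral_exp_smul, ← hΦ]
    congr 1
    ext v
    rw [hp, smul_eq_mul, ← mul_assoc, ← Complex.exp_add]
    congr 2
    push_cast
    ring
  have hFκ : ∀ ξ : ℝ, FourierTransform.fourier κ ξ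
      = boxKernel η ((-c : ℝ) + ((-2 * π * ξ : ℝ) : ℂ) * Complex.I) := by
    intro ξ
    set z : ℂ := (-c : ℝ) + ((-2 * π * ξ : ℝ) : ℂ) * Complex.I with hz
    have hz0 : z ≠ 0 := by
      intro h
      have := congrArg Complex.re h
      simp [hz] at this
      exact hc.ne' this
    have hη0 : (η : ℂ) ≠ 0 := by exact_mod_cast hη.ne'
    rw [Real.fourier_real_eq_integral_exp_smul, boxKernel_of_ne_zero η hz0]
    have h1 : (fun v : ℝ => Complex.exp (((-2 * π * v * ξ : ℝ) : ℂ) * Complex.I) • κ v) =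
        (Set.Ioc (-η) 0).indicator fun v => (1 / (η : ℂ)) * Complex.exp (z * v) := by
      ext v
      simp only [hκ, Set.indicator_apply, smul_eq_mul]
      split_ifs
      · rw [mul_left_comm, ← Complex.exp_add]
        congr 2
        rw [hz]
        push_cast
        ring
      · simp
    rw [h1, integral_indicator measurableSet_Ioc, integral_const_mul,
      ← intervalIntegral.integral_of_le (by linarith), integral_exp_mul_complex hz0]
    simp only [Complex.ofReal_zero, mul_zero, Complex.exp_zero, Complex.ofReal_neg, mul_neg,
      neg_mul]
    rw [mul_comm z]
    field_simp
  have hFf : ∀ ξ : ℝ, FourierTransform.fourier f ξ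
      = boxKernel η ((-c : ℝ) + ((-2 * π * ξ : ℝ) : ℂ) * Complex.I) *
        Φ ((-c : ℝ) + ((-2 * π * ξ : ℝ) : ℂ) * Complex.I) := by
    intro ξ
    rw [hf, Real.fourier_mul_convolution_eq hκint hw, hFκ, hFp]
  have h2π : (-2 * π : ℝ) ≠ 0 := by simp [Real.pi_ne_zero]
  have hFint : Integrable (FourierTransform.fourier f) := by
    have : FourierTransform.fourier f = fun ξ : ℝ => (fun y : ℝ =>
        boxKernel η ((-c : ℝ) + y * Complex.I) * Φ ((-c : ℝ) + y * Complex.I)) (-2 * π * ξ) :=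
      funext hFf
    rw [this]
    exact hint.comp_mul_left' h2π
  have hinv := congrFun (hfc.fourierInv_fourier_eq hfint hFint) x
  rw [Real.fourierInv_eq'] at hinv
  have h3 : (fun v : ℝ => Complex.exp (((2 * π * inner ℝ v x : ℝ) : ℂ) * Complex.I) •
      FourierTransform.fourier f v) = fun v : ℝ => (fun y : ℝ =>
        Complex.exp (-(c : ℂ) * x) * (Complex.exp (-(x : ℂ) * ((-c : ℝ) + y * Complex.I)) *
          (boxKernel η ((-c : ℝ) + y * Complex.I) * Φ ((-c : ℝ) + y * Complex.I))))
        (-2 * π * v) := by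
    ext v
    simp only
    rw [hFf, smul_eq_mul, ← mul_assoc (Complex.exp (-(c : ℂ) * x)), ← Complex.exp_add]
    congr 2
    simp
    ring
  rw [h3, Measure.integral_comp_mul_left (fun y : ℝ =>
        Complex.exp (-(c : ℂ) * x) * (Complex.exp (-(x : ℂ) * ((-c : ℝ) + y * Complex.I)) *
          (boxKernel η ((-c : ℝ) + y * Complex.I) * Φ ((-c : ℝ) + y * Complex.I)))),
    integral_const_mul, hfx] at hinv
  have hcancel : ((-2 * π)⁻¹ : ℝ) = -(1 / (2 * π)) := by
    rw [neg_mul, inv_neg, one_div]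
  rw [hcancel, abs_neg, abs_of_pos (by positivity)] at hinv
  rw [← mul_smul_comm] at hinv
  exact (mul_left_cancel₀ (Complex.exp_ne_zero _) hinv).symm

/-- On the shifted line Re z = b the factor e^{-xz} has modulus e^{-bx}, while kernel and transform
together decay like (1 + |y|)^{-(1+δ)}. The constant depends on neither x nor η. -/
lemma exists_norm_integral_box_le {w : ℝ → ℂ} {Φ : ℂ → ℂ} {c b C δ : ℝ} (hc : 0 < c) (hb : 0 < b)
    (hδ : 0 < δ) (hδ1 : δ ≤ 1)
    (hw : Integrable fun x : ℝ => Complex.exp (-(c : ℂ) * x) * w x)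
    (hΦ : ∀ y : ℝ, ∫ x : ℝ, Complex.exp (((-c : ℝ) + y * Complex.I) * x) * w x
      = Φ ((-c : ℝ) + y * Complex.I))
    (hd : DifferentiableOn ℂ Φ {z | -c ≤ z.re ∧ z.re ≤ b})
    (hC : ∀ z : ℂ, -c ≤ z.re → z.re ≤ b → ‖Φ z‖ ≤ C / (1 + |z.im|)) :
    ∃ B, 0 ≤ B ∧ ∀ x η : ℝ, 0 < η →
      ‖∫ u in x..(x + η), w u‖ ≤ η * (B * (Real.exp (-b * x) * η ^ (-δ))) := by
  -- Chosen so that κ(1 + |y|) ≤ |b + iy|.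
  set κ : ℝ := min b 1 / 2 with hκ
  have hκ0 : 0 < κ := by positivity
  have hC0 : 0 ≤ C := by
    have := (norm_nonneg _).trans (hC 0 (by simp [hc.le]) (by simp [hb.le]))
    simpa using this
  set J : ℝ := ∫ y : ℝ, (1 + ‖y‖) ^ (-(1 + δ)) with hJ
  have hJint : Integrable fun y : ℝ => (1 + ‖y‖) ^ (-(1 + δ)) :=
    integrable_one_add_norm (by simp [hδ])
  have hJ0 : 0 ≤ J := integral_nonneg fun y => by positivity
  refine ⟨1 / (2 * π) * (2 * κ ^ (-δ) * C * J), by positivity, fun x η hη => ?_⟩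
  -- Quadratic decay, needed only to justify integrability and the shift; A may depend on x and η,
  -- as it does not enter the final bound.
  have hstrip : ∀ x : ℝ, ∃ A, ∀ z : ℂ, -c ≤ z.re → z.re ≤ b →
      ‖Complex.exp (-(x : ℂ) * z) * (boxKernel η z * Φ z)‖ ≤ A / (1 + z.im ^ 2) := by
    intro x
    have hcont : Continuous fun z => Complex.exp (-(x : ℂ) * z) * boxKernel η z :=
      Continuous.mul (by fun_prop) (differentiable_boxKernel η).continuous
    obtain ⟨A, hA0, hA⟩ := exists_bound_div_one_add_abs_im (a := -c) (b := b) le_rfl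
      hcont.continuousOn
      (A := Real.exp (|x| * max b c) * ((1 + Real.exp (η * c)) / η)) (fun z h1 h2 h3 => by
        have hz0 : z ≠ 0 := by
          rintro rfl
          simp at h3
          linarith
        have him : 0 < |z.im| := by linarith
        rw [norm_mul, boxKernel_of_ne_zero η hz0, norm_div, norm_mul, Complex.norm_real,
          Real.norm_of_nonneg hη.le, mul_div_assoc, div_div]
        have e1 : ‖Complex.exp (-(x : ℂ) * z)‖ ≤ Real.exp (|x| * max b c) := by
          rw [Complex.norm_exp, Real.exp_le_exp]
          simp only [Complex.mul_re, Complex.neg_re, Complex.ofReal_re, Complex.neg_im,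
            Complex.ofReal_im, neg_zero, zero_mul, sub_zero]
          refine (le_abs_self _).trans ?_
          rw [abs_mul, abs_neg]
          gcongr
          exact abs_le.2 ⟨by linarith [le_max_right b c], by linarith [le_max_left b c]⟩
        have e2 : ‖1 - Complex.exp (-(η : ℂ) * z)‖ ≤ 1 + Real.exp (η * c) := by
          refine (norm_sub_le _ _).trans ?_
          rw [norm_one, Complex.norm_exp]
          gcongr
          simp only [Complex.mul_re, Complex.neg_re, Complex.ofReal_re, Complex.neg_im,
            Complex.ofReal_im, neg_zero, zero_mul, sub_zero]
          nlinarith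
        gcongr
        exact Complex.abs_im_le_norm z)
    refine ⟨A * C, fun z h1 h2 => ?_⟩
    rw [← mul_assoc, norm_mul]
    calc _ ≤ (A / (1 + |z.im|)) * (C / (1 + |z.im|)) := by
          gcongr
          · exact hA z h1 h2
          · exact hC z h1 h2
      _ = A * C / ((1 + |z.im|) * (1 + |z.im|)) := by rw [div_mul_div_comm]
      _ ≤ _ := by
          gcongr
          nlinarith [sq_abs z.im, abs_nonneg z.im]
  have hdiff : ∀ x : ℝ, DifferentiableOn ℂ
      (fun z => Complex.exp (-(x : ℂ) * z) * (boxKernel η z * Φ z))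
      {z | -c ≤ z.re ∧ z.re ≤ b} := fun x =>
    DifferentiableOn.mul (by fun_prop) ((differentiable_boxKernel η).differentiableOn.mul hd)
  have hint : Integrable fun y : ℝ =>
      boxKernel η ((-c : ℝ) + y * Complex.I) * Φ ((-c : ℝ) + y * Complex.I) := by
    obtain ⟨A, hA⟩ := hstrip 0
    simpa using integrable_vertical (hdiff 0) hA (t := -c) le_rfl (by linarith)
  obtain ⟨A, hA⟩ := hstrip x
  have h1 := integral_box_eq hc hη hw hΦ hint x
  have hshift := integral_vertical_eq (a := -c) (b := b) (by linarith) (hdiff x) hA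
  rw [hshift] at h1
  have hbound : ‖∫ y : ℝ, Complex.exp (-(x : ℂ) * (b + y * Complex.I)) *
      (boxKernel η (b + y * Complex.I) * Φ (b + y * Complex.I))‖
      ≤ Real.exp (-b * x) * η ^ (-δ) * (2 * κ ^ (-δ) * C) * J := by
    rw [hJ, ← integral_const_mul]
    refine norm_integral_le_of_norm_le (hJint.const_mul _) (Eventually.of_forall fun y => ?_)
    set z : ℂ := b + y * Complex.I with hz
    have hzre : z.re = b := by simp [hz]
    have hzim : z.im = y := by simp [hz]
    have e1 : ‖Complex.exp (-(x : ℂ) * z)‖ = Real.exp (-b * x) := by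
      rw [Complex.norm_exp]
      simp [hzre, mul_comm]
    have e2 := norm_boxKernel_le_rpow hη (z := z) (by rw [hzre]; exact hb) hδ hδ1
    have e3 := hC z (by rw [hzre]; linarith) hzre.le
    rw [hzim] at e3
    have e4 : κ * (1 + |y|) ≤ ‖z‖ := by
      have h1 := Complex.abs_re_le_norm z
      have h2 := Complex.abs_im_le_norm z
      rw [hzre, abs_of_pos hb] at h1
      rw [hzim] at h2
      have h3 : min b 1 ≤ b := min_le_left _ _
      have h4 : min b 1 ≤ 1 := min_le_right _ _
      rw [hκ]
      nlinarith [abs_nonneg y]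
    have hy : 0 < 1 + |y| := by positivity
    have e5 : ‖z‖ ^ (-δ) ≤ κ ^ (-δ) * (1 + |y|) ^ (-δ) := by
      rw [← Real.mul_rpow hκ0.le hy.le]
      exact Real.rpow_le_rpow_of_nonpos (by positivity) e4 (by linarith)
    rw [norm_mul, norm_mul, e1, Real.norm_eq_abs]
    calc Real.exp (-b * x) * (‖boxKernel η z‖ * ‖Φ z‖)
        ≤ Real.exp (-b * x) * ((2 * (η ^ (-δ) * (κ ^ (-δ) * (1 + |y|) ^ (-δ)))) *
          (C / (1 + |y|))) := by
          gcongr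
          exact e2.trans (by gcongr)
      _ = _ := by
          rw [neg_add, Real.rpow_add hy, Real.rpow_neg_one]
          field_simp
  have h2 : (∫ u in x..(x + η), w u) = (η : ℂ) * ((1 / (2 * π : ℝ) : ℝ) •
      ∫ y : ℝ, Complex.exp (-(x : ℂ) * (b + y * Complex.I)) *
      (boxKernel η (b + y * Complex.I) * Φ (b + y * Complex.I))) := by
    rw [← h1]
    have hη0 : (η : ℂ) ≠ 0 := by exact_mod_cast hη.ne'
    field_simp
  rw [h2, norm_mul, norm_smul, Complex.norm_real, Real.norm_of_nonneg hη.le, Real.norm_of_nonneg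
    (by positivity)]
  refine mul_le_mul_of_nonneg_left ?_ hη.le
  calc _ ≤ 1 / (2 * π) * (Real.exp (-b * x) * η ^ (-δ) * (2 * κ ^ (-δ) * C) * J) := by gcongr
    _ = _ := by ring

/-! ### Exponential monomials -/

/-- Half of the exponential decay absorbs x^k, through (tx)^k/k! ≤ e^{tx} with t = Re s / 2. -/
lemma norm_pow_mul_exp_le (k : ℕ) {s : ℂ} (hs : 0 < s.re) {x : ℝ} (hx : 0 ≤ x) :
    ‖(x : ℂ) ^ k * Complex.exp (-s * x)‖
      ≤ k.factorial / (s.re / 2) ^ k * Real.exp (-(s.re / 2) * x) := by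
  have ht : 0 < s.re / 2 := by positivity
  have h := Real.pow_div_factorial_le_exp (x := s.re / 2 * x) (by positivity) k
  rw [div_le_iff₀ (by positivity), mul_pow] at h
  have h2 : x ^ k ≤ k.factorial / (s.re / 2) ^ k * Real.exp (s.re / 2 * x) := by
    rw [div_mul_eq_mul_div, le_div_iff₀ (by positivity)]
    linarith
  rw [norm_mul, norm_pow, Complex.norm_real, Real.norm_of_nonneg hx, Complex.norm_exp]
  have h3 : (-s * (x : ℂ)).re = -(s.re / 2) * x - s.re / 2 * x := by simp; ring
  rw [h3, Real.exp_sub]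
  calc x ^ k * (Real.exp (-(s.re / 2) * x) / Real.exp (s.re / 2 * x))
      ≤ k.factorial / (s.re / 2) ^ k * Real.exp (s.re / 2 * x) *
        (Real.exp (-(s.re / 2) * x) / Real.exp (s.re / 2 * x)) := by gcongr
    _ = _ := by field_simp

lemma integrableOn_pow_mul_exp (k : ℕ) {s : ℂ} (hs : 0 < s.re) :
    IntegrableOn (fun x : ℝ => (x : ℂ) ^ k * Complex.exp (-s * x)) (Set.Ioi 0) := by
  have hi := (integrableOn_exp_mul_Ioi (a := -(s.re / 2)) (by linarith) 0).const_mul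
    (k.factorial / (s.re / 2) ^ k : ℝ)
  refine Integrable.mono' hi (Continuous.aestronglyMeasurable (by fun_prop)) ?_
  filter_upwards [ae_restrict_mem measurableSet_Ioi] with x hx
  exact norm_pow_mul_exp_le k hs (le_of_lt hx)

lemma integral_pow_mul_exp (k : ℕ) {s : ℂ} (hs : 0 < s.re) :
    ∫ x in Set.Ioi (0 : ℝ), (x : ℂ) ^ k * Complex.exp (-s * x)
      = k.factorial * (s⁻¹) ^ (k + 1) := by
  have hs0 : s ≠ 0 := by rintro rfl; simp at hs
  induction k with
  | zero =>
    have := integral_exp_mul_complex_Ioi (a := -s) (by simpa using hs) 0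
    simp only [pow_zero, one_mul, this]
    simp
  | succ k ih =>
    have hderiv : ∀ x ∈ Set.Ici (0 : ℝ),
        HasDerivAt (fun x : ℝ => (x : ℂ) ^ (k + 1) * Complex.exp (-s * x))
          ((k + 1 : ℂ) * ((x : ℂ) ^ k * Complex.exp (-s * x)) -
            s * ((x : ℂ) ^ (k + 1) * Complex.exp (-s * x))) x := by
      intro x _
      have h1 := (hasDerivAt_pow (k + 1) (x : ℂ)).mul
        (((hasDerivAt_id (x : ℂ)).const_mul (-s)).cexp)
      refine h1.comp_ofReal.congr_deriv ?_
      simp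
      ring
    have hlim : Tendsto (fun x : ℝ => (x : ℂ) ^ (k + 1) * Complex.exp (-s * x)) atTop (𝓝 0) := by
      have h0 : Tendsto (fun x : ℝ => ((k + 1).factorial / (s.re / 2) ^ (k + 1) : ℝ) *
          Real.exp (-(s.re / 2) * x)) atTop (𝓝 0) := by
        have : Tendsto (fun x : ℝ => -(s.re / 2) * x) atTop atBot :=
          tendsto_id.const_mul_atTop_of_neg (by linarith)
        simpa using (Real.tendsto_exp_atBot.comp this).const_mul
          ((k + 1).factorial / (s.re / 2) ^ (k + 1) : ℝ)
      refine squeeze_zero_norm' ?_ h0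
      filter_upwards [eventually_ge_atTop 0] with x hx using norm_pow_mul_exp_le (k + 1) hs hx
    have hi1 := (integrableOn_pow_mul_exp k hs).const_mul (k + 1 : ℂ)
    have hi2 := (integrableOn_pow_mul_exp (k + 1) hs).const_mul s
    have h := integral_Ioi_of_hasDerivAt_of_tendsto' hderiv (hi1.sub hi2) hlim
    rw [integral_sub hi1 hi2, integral_const_mul, integral_const_mul, ih] at h
    simp only [Complex.ofReal_zero, ne_eq, Nat.add_eq_zero_iff, one_ne_zero, and_false,
      not_false_eq_true, zero_pow, zero_mul, sub_zero] at h
    have h2 := sub_eq_zero.1 h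
    have h3 : ∫ x in Set.Ioi (0 : ℝ), (x : ℂ) ^ (k + 1) * Complex.exp (-s * x)
        = s⁻¹ * ((k + 1 : ℂ) * (k.factorial * (s⁻¹) ^ (k + 1))) := by
      rw [h2, inv_mul_cancel_left₀ hs0]
    rw [h3, Nat.factorial_succ]
    push_cast
    ring

/-- The residue at `ζ` of `exp (-x z) / (z - ζ) ^ (k + 1)`. -/
noncomputable def expMonomial (k : ℕ) (ζ : ℂ) (x : ℝ) : ℂ :=
  (-(x : ℂ)) ^ k / k.factorial * Complex.exp (-(x : ℂ) * ζ)

lemma cexp_mul_expMonomial (k : ℕ) (ζ z : ℂ) (x : ℝ) :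
    Complex.exp (z * x) * expMonomial k ζ x =
      ((-1) ^ k / k.factorial : ℂ) * ((x : ℂ) ^ k * Complex.exp (-(ζ - z) * x)) := by
  have : -(ζ - z) * (x : ℂ) = z * x + -(x : ℂ) * ζ := by ring
  rw [this, Complex.exp_add, expMonomial, neg_pow]
  ring

lemma integrableOn_cexp_mul_expMonomial (k : ℕ) {ζ z : ℂ} (h : z.re < ζ.re) :
    IntegrableOn (fun x : ℝ => Complex.exp (z * x) * expMonomial k ζ x) (Set.Ioi 0) := by
  simp_rw [cexp_mul_expMonomial]
  exact (integrableOn_pow_mul_exp k (by simpa using h)).const_mul _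

/-- Subtracting a multiple of this monomial from U removes the matching term of the principal part
from its transform. -/
lemma laplace_expMonomial (k : ℕ) {ζ z : ℂ} (h : z.re < ζ.re) :
    ∫ x in Set.Ioi (0 : ℝ), Complex.exp (z * x) * expMonomial k ζ x = -((z - ζ)⁻¹) ^ (k + 1) := by
  simp_rw [cexp_mul_expMonomial]
  rw [integral_const_mul, integral_pow_mul_exp k (by simpa using h), ← neg_sub z ζ, inv_neg,
    neg_pow _ (k + 1), pow_succ (-1 : ℂ)]
  have h2 : ((-1 : ℂ) ^ k) * (-1) ^ k = 1 := by rw [← mul_pow]; simp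
  have h3 : (k.factorial : ℂ) ≠ 0 := by exact_mod_cast k.factorial_ne_zero
  field_simp
  linear_combination (-((z - ζ)⁻¹) ^ (k + 1)) * h2

lemma norm_expMonomial_le (k : ℕ) {ζ : ℂ} (hζ : 0 ≤ ζ.re) {x : ℝ} (hx : 0 ≤ x) :
    ‖expMonomial k ζ x‖ ≤ Real.exp x := by
  rw [expMonomial, norm_mul, norm_div, norm_pow, norm_neg, Complex.norm_real,
    Real.norm_of_nonneg hx, Complex.norm_natCast, Complex.norm_exp]
  have h1 := Real.pow_div_factorial_le_exp x hx k
  have h2 : Real.exp (-(x : ℂ) * ζ).re ≤ 1 := by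
    rw [Real.exp_le_one_iff]
    simp
    positivity
  calc _ ≤ Real.exp x * 1 := by gcongr
    _ = _ := mul_one _

lemma hasDerivAt_expMonomial (k : ℕ) (ζ : ℂ) (x : ℝ) :
    HasDerivAt (expMonomial k ζ)
      (-(if k = 0 then 0 else expMonomial (k - 1) ζ x) - ζ * expMonomial k ζ x) x := by
  have h1 := ((((hasDerivAt_id (x : ℂ)).neg).pow k).div_const (k.factorial : ℂ)).mul
    (((hasDerivAt_id (x : ℂ)).neg.mul_const ζ).cexp)
  refine h1.comp_ofReal.congr_deriv ?_
  rcases k with _ | k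
  · simp [expMonomial]; ring
  · have h3 : (k.factorial : ℂ) ≠ 0 := by exact_mod_cast k.factorial_ne_zero
    have h4 : (k + 1 : ℂ) ≠ 0 := by exact_mod_cast k.succ_ne_zero
    simp [expMonomial, Nat.factorial_succ]
    field_simp
    ring

/-- The growth e^x is crude but harmless: the increment u will be at most e^{-(b+1)x}. -/
lemma norm_expMonomial_sub_le (k : ℕ) {ζ : ℂ} (hζ : 0 ≤ ζ.re) {x u : ℝ} (hx : 0 ≤ x)
    (hu : 0 ≤ u) (hu1 : u ≤ 1) :
    ‖expMonomial k ζ (x + u) - expMonomial k ζ x‖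
      ≤ (1 + ‖ζ‖) * Real.exp 1 * Real.exp x * u := by
  have h := norm_image_sub_le_of_norm_deriv_le_segment' (f := expMonomial k ζ) (a := x)
    (b := x + u) (C := (1 + ‖ζ‖) * Real.exp 1 * Real.exp x)
    (fun y _ => (hasDerivAt_expMonomial k ζ y).hasDerivWithinAt) (fun y hy => ?_) (x + u)
    (Set.right_mem_Icc.2 (by linarith))
  · simpa using h
  · have hy0 : 0 ≤ y := hx.trans hy.1
    have h1 : ‖(if k = 0 then 0 else expMonomial (k - 1) ζ y)‖ ≤ Real.exp y := by
      split_ifs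
      · simpa using (Real.exp_pos y).le
      · exact norm_expMonomial_le _ hζ hy0
    have h2 := norm_expMonomial_le k hζ hy0
    calc _ ≤ ‖-(if k = 0 then 0 else expMonomial (k - 1) ζ y)‖ + ‖ζ * expMonomial k ζ y‖ :=
          norm_sub_le _ _
      _ ≤ Real.exp y + ‖ζ‖ * Real.exp y := by
          rw [norm_neg, norm_mul]
          gcongr
      _ = (1 + ‖ζ‖) * Real.exp y := by ring
      _ ≤ (1 + ‖ζ‖) * Real.exp (1 + x) := by
          gcongr
          linarith [hy.2]
      _ = _ := by rw [Real.exp_add]; ring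

/-! ### A Tauberian estimate -/

/-- Box averages of a function that does not decrease too fast control the function. -/
lemma abs_le_of_integral_box_le {s : ℝ → ℝ} {L B b δ : ℝ} (hL : 0 ≤ L) (hB : 0 ≤ B) (hb : 0 ≤ b)
    (hs : ∀ x u : ℝ, 0 < x → 0 ≤ u → u ≤ 1 → s x - L * Real.exp x * u ≤ s (x + u))
    (hint : ∀ x y : ℝ, IntervalIntegrable s volume x y)
    (hbox : ∀ x η : ℝ, 0 < η →
      |∫ u in x..(x + η), s u| ≤ η * (B * (Real.exp (-b * x) * η ^ (-δ))))
    {x η : ℝ} (hη : 0 < η) (hη1 : η ≤ 1) (hx : 1 < x) :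
    |s x| ≤ B * Real.exp b * (Real.exp (-b * x) * η ^ (-δ)) + L * Real.exp x * η := by
  -- The forward average bounds s(x) from above; the backward one, over [x - η, x], bounds it from
  -- below. Here η ≤ 1 < x keeps x - η positive.
  have hup : η * (s x - L * Real.exp x * η) ≤ ∫ u in x..(x + η), s u := by
    have h1 : ∫ _ in x..(x + η), (s x - L * Real.exp x * η) = η * (s x - L * Real.exp x * η) := by
      simp
      ring
    rw [← h1]
    refine intervalIntegral.integral_mono_on (by linarith) (by simp) (hint _ _) fun y hy => ?_
    have h2 := hs x (y - x) (by linarith) (by linarith [hy.1]) (by linarith [hy.2])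
    rw [add_sub_cancel] at h2
    refine le_trans ?_ h2
    gcongr
    linarith [hy.2]
  have hlo : ∫ u in (x - η)..(x - η + η), s u ≤ η * (s x + L * Real.exp x * η) := by
    have h1 : ∫ _ in (x - η)..(x - η + η), (s x + L * Real.exp x * η)
        = η * (s x + L * Real.exp x * η) := by
      simp
      ring
    rw [← h1]
    refine intervalIntegral.integral_mono_on (by linarith) (hint _ _) (by simp) fun y hy => ?_
    rw [sub_add_cancel] at hy
    have h2 := hs y (x - y) (by linarith [hy.1]) (by linarith [hy.2]) (by linarith [hy.1])
    rw [add_sub_cancel] at h2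
    have h3 : L * Real.exp y * (x - y) ≤ L * Real.exp x * η := by
      have := hy.2
      have := sub_nonneg.2 hy.2
      gcongr
      linarith [hy.1]
    linarith
  have hb1 := (abs_le.1 (hbox x η hη)).2
  have hb2 := (abs_le.1 (hbox (x - η) η hη)).1
  have h1 := le_of_mul_le_mul_left (hup.trans hb1) hη
  have h2 : -(B * (Real.exp (-b * (x - η)) * η ^ (-δ))) ≤ s x + L * Real.exp x * η := by
    refine le_of_mul_le_mul_left ?_ hη
    linarith [hb2.trans hlo]
  have hηδ : 0 ≤ η ^ (-δ) := by positivity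
  have e1 : Real.exp (-b * (x - η)) ≤ Real.exp b * Real.exp (-b * x) := by
    rw [← Real.exp_add, Real.exp_le_exp]
    nlinarith
  have e2 : Real.exp (-b * x) ≤ Real.exp b * Real.exp (-b * x) :=
    le_mul_of_one_le_left (Real.exp_pos _).le (Real.one_le_exp hb)
  have f1 : B * (Real.exp (-b * (x - η)) * η ^ (-δ)) ≤
      B * Real.exp b * (Real.exp (-b * x) * η ^ (-δ)) := by
    calc _ ≤ B * ((Real.exp b * Real.exp (-b * x)) * η ^ (-δ)) := by gcongr
      _ = _ := by ring
  have f2 : B * (Real.exp (-b * x) * η ^ (-δ)) ≤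
      B * Real.exp b * (Real.exp (-b * x) * η ^ (-δ)) := by
    calc _ ≤ B * ((Real.exp b * Real.exp (-b * x)) * η ^ (-δ)) := by gcongr
      _ = _ := by ring
  exact abs_le.2 ⟨by linarith, by linarith⟩

/-- The previous estimate with `η = exp (-(b + 1) x)`. -/
lemma abs_le_exp_of_integral_box_le {s : ℝ → ℝ} {L B b δ : ℝ} (hL : 0 ≤ L) (hB : 0 ≤ B)
    (hb : 0 ≤ b) (hδ : 0 ≤ δ)
    (hs : ∀ x u : ℝ, 0 < x → 0 ≤ u → u ≤ 1 → s x - L * Real.exp x * u ≤ s (x + u))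
    (hint : ∀ x y : ℝ, IntervalIntegrable s volume x y)
    (hbox : ∀ x η : ℝ, 0 < η →
      |∫ u in x..(x + η), s u| ≤ η * (B * (Real.exp (-b * x) * η ^ (-δ)))) {x : ℝ} (hx : 1 < x) :
    |s x| ≤ (B * Real.exp b + L) * Real.exp (-(b - δ * (b + 1)) * x) := by
  have h := abs_le_of_integral_box_le hL hB hb hs hint hbox (η := Real.exp (-(b + 1) * x))
    (Real.exp_pos _) (Real.exp_le_one_iff.2 (by nlinarith)) hx
  rw [← Real.exp_mul, ← Real.exp_add, mul_assoc L, ← Real.exp_add] at h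
  refine h.trans ?_
  -- This η makes the term L e^x η equal to L e^{-bx}, at the cost of η^{-δ} = e^{δ(b+1)x} in the
  -- other.
  have e1 : -b * x + -(b + 1) * x * -δ = -(b - δ * (b + 1)) * x := by ring
  rw [e1, add_mul]
  gcongr
  have : 0 ≤ δ * (b + 1) * x := by positivity
  linarith

/-! ### The asymptotic expansion -/

/-- High up in the strip |z - ζ| ≥ |Im z|/2, and for |Im z| ≥ 1 every negative power is dominated by
the first. -/
lemma norm_sum_principalParts_le (Z : Finset ℂ) (n : ℂ → ℕ) (a : ℂ → ℕ → ℂ) {z : ℂ}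
    (hz : 1 ≤ |z.im|) (hZ : ∀ ζ ∈ Z, 2 * |ζ.im| ≤ |z.im|) :
    ‖∑ ζ ∈ Z, ∑ k ∈ Finset.range (n ζ), a ζ k * ((z - ζ)⁻¹) ^ (k + 1)‖ ≤
      (∑ ζ ∈ Z, ∑ k ∈ Finset.range (n ζ), ‖a ζ k‖ * 2 ^ (k + 1)) / |z.im| := by
  have him : 0 < |z.im| := by linarith
  rw [Finset.sum_div]
  refine norm_sum_le_of_le _ fun ζ hζ => ?_
  rw [Finset.sum_div]
  refine norm_sum_le_of_le _ fun k _ => ?_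
  have h1 : |z.im| / 2 ≤ ‖z - ζ‖ := by
    have h2 := Complex.abs_im_le_norm (z - ζ)
    rw [Complex.sub_im] at h2
    linarith [abs_sub_abs_le_abs_sub z.im ζ.im, hZ ζ hζ]
  have h2 : ‖(z - ζ)⁻¹‖ ≤ 2 / |z.im| := by
    rw [norm_inv, ← inv_div]
    exact inv_anti₀ (by positivity) h1
  rw [norm_mul, norm_pow, mul_div_assoc]
  gcongr
  calc ‖(z - ζ)⁻¹‖ ^ (k + 1) ≤ (2 / |z.im|) ^ (k + 1) := by gcongr
    _ = 2 ^ (k + 1) / |z.im| ^ (k + 1) := by rw [div_pow]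
    _ ≤ 2 ^ (k + 1) / |z.im| := by
        gcongr
        exact le_self_pow₀ hz (by simp)

/-- The renewal function minus an exponential polynomial, cut off at `0`. -/
noncomputable def truncatedRemainder (F : Measure ℝ) (Z : Finset ℂ) (n : ℂ → ℕ) (a : ℂ → ℕ → ℂ) :
    ℝ → ℂ :=
  (Set.Ioi 0).indicator fun x => ((renewalFunction F x).toReal : ℂ) -
    ∑ ζ ∈ Z, ∑ k ∈ Finset.range (n ζ), a ζ k * expMonomial k ζ x

lemma cexp_mul_truncatedRemainder (F : Measure ℝ) (Z : Finset ℂ) (n : ℂ → ℕ) (a : ℂ → ℕ → ℂ)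
    (z : ℂ) : (fun x : ℝ => Complex.exp (z * x) * truncatedRemainder F Z n a x) =
      (Set.Ioi 0).indicator fun x : ℝ =>
        Complex.exp (z * x) * ((renewalFunction F x).toReal : ℂ) -
        ∑ ζ ∈ Z, ∑ k ∈ Finset.range (n ζ), a ζ k * (Complex.exp (z * x) * expMonomial k ζ x) := by
  ext x
  simp only [truncatedRemainder, Set.indicator_apply]
  split_ifs
  · simp only [mul_sub, Finset.mul_sum]
    congr 1
    refine Finset.sum_congr rfl fun ζ _ => Finset.sum_congr rfl fun k _ => ?_
    ring
  · simp

lemma laplace_truncatedRemainder {F : Measure ℝ} [IsProbabilityMeasure F]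
    (hF : ∀ᵐ x ∂F, 0 ≤ x) (hlat : ¬ IsLattice F) {Z : Finset ℂ} (hZ : ∀ ζ ∈ Z, 0 ≤ ζ.re)
    (n : ℂ → ℕ) (a : ℂ → ℕ → ℂ) {z : ℂ} (hz : z.re < 0) :
    Integrable (fun x : ℝ => Complex.exp (z * x) * truncatedRemainder F Z n a x) ∧
    ∫ x : ℝ, Complex.exp (z * x) * truncatedRemainder F Z n a x =
      -(1 / (z * (1 - complexMGF id F z)) -
        ∑ ζ ∈ Z, ∑ k ∈ Finset.range (n ζ), a ζ k * ((z - ζ)⁻¹) ^ (k + 1)) := by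
  have hU := integrable_cexp_mul_renewalFunction hF hlat hz
  have hterm : ∀ ζ ∈ Z, ∀ k, IntegrableOn
      (fun x : ℝ => a ζ k * (Complex.exp (z * x) * expMonomial k ζ x)) (Set.Ioi 0) :=
    fun ζ hζ k =>
      (integrableOn_cexp_mul_expMonomial k (hz.trans_le (hZ ζ hζ))).const_mul (a ζ k)
  have hinner : ∀ ζ ∈ Z, IntegrableOn (fun x : ℝ => ∑ k ∈ Finset.range (n ζ),
      a ζ k * (Complex.exp (z * x) * expMonomial k ζ x)) (Set.Ioi 0) := fun ζ hζ =>
    integrable_finsetSum _ fun k _ => hterm ζ hζ k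
  have hsum := integrable_finsetSum Z hinner
  rw [cexp_mul_truncatedRemainder]
  refine ⟨(integrable_indicator_iff measurableSet_Ioi).2 (hU.sub hsum), ?_⟩
  rw [integral_indicator measurableSet_Ioi, integral_sub hU hsum,
    laplace_renewalFunction hF hlat hz, integral_finsetSum _ hinner]
  have : ∀ ζ ∈ Z, ∫ x in Set.Ioi (0 : ℝ), ∑ k ∈ Finset.range (n ζ),
      a ζ k * (Complex.exp (z * x) * expMonomial k ζ x) =
      -∑ k ∈ Finset.range (n ζ), a ζ k * ((z - ζ)⁻¹) ^ (k + 1) := by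
    intro ζ hζ
    rw [integral_finsetSum _ fun k _ => hterm ζ hζ k, ← Finset.sum_neg_distrib]
    refine Finset.sum_congr rfl fun k _ => ?_
    rw [integral_const_mul, laplace_expMonomial k (hz.trans_le (hZ ζ hζ))]
    ring
  rw [Finset.sum_congr rfl this, Finset.sum_neg_distrib]
  ring

lemma exists_norm_expPolynomial_sub_le {Z : Finset ℂ} (hZ : ∀ ζ ∈ Z, 0 ≤ ζ.re)
    (n : ℂ → ℕ) (a : ℂ → ℕ → ℂ) : ∃ L, 0 ≤ L ∧ ∀ x u : ℝ, 0 < x → 0 ≤ u → u ≤ 1 →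
      ‖(∑ ζ ∈ Z, ∑ k ∈ Finset.range (n ζ), a ζ k * expMonomial k ζ (x + u)) -
        ∑ ζ ∈ Z, ∑ k ∈ Finset.range (n ζ), a ζ k * expMonomial k ζ x‖ ≤ L * Real.exp x * u := by
  refine ⟨∑ ζ ∈ Z, ∑ k ∈ Finset.range (n ζ), ‖a ζ k‖ * ((1 + ‖ζ‖) * Real.exp 1),
    Finset.sum_nonneg fun ζ _ => Finset.sum_nonneg fun k _ => by positivity,
    fun x u hx hu hu1 => ?_⟩
  simp only [← Finset.sum_sub_distrib, Finset.sum_mul]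
  refine norm_sum_le_of_le _ fun ζ hζ => norm_sum_le_of_le _ fun k _ => ?_
  rw [← mul_sub, norm_mul, mul_assoc, mul_assoc]
  gcongr
  rw [← mul_assoc]
  exact norm_expMonomial_sub_le k (hZ ζ hζ) hx.le hu hu1

lemma exists_norm_truncatedRemainder_le {F : Measure ℝ} [IsProbabilityMeasure F]
    (hF : ∀ᵐ x ∂F, 0 ≤ x) (hlat : ¬ IsLattice F) {Z : Finset ℂ} (hZ : ∀ ζ ∈ Z, 0 ≤ ζ.re)
    (n : ℂ → ℕ) (a : ℂ → ℕ → ℂ) {Φ : ℂ → ℂ} {c b C R₀ : ℝ} (hc : 0 < c) (h0 : 0 < R₀)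
    (hb : R₀ < b)
    (hΦ : ∀ z : ℂ, z.re < 0 → Φ z = -(1 / (z * (1 - complexMGF id F z)) -
        ∑ ζ ∈ Z, ∑ k ∈ Finset.range (n ζ), a ζ k * ((z - ζ)⁻¹) ^ (k + 1)))
    (hd : DifferentiableOn ℂ Φ {z | -c ≤ z.re ∧ z.re ≤ b})
    (hC : ∀ z : ℂ, -c ≤ z.re → z.re ≤ b → ‖Φ z‖ ≤ C / (1 + |z.im|)) :
    ∃ A r, R₀ < r ∧ ∀ x : ℝ, 1 < x →
      ‖truncatedRemainder F Z n a x‖ ≤ A * Real.exp (-r * x) := by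
  set w := truncatedRemainder F Z n a with hw
  -- Then δ(b + 1) = (b - R₀)/2, so the final rate b - δ(b + 1) is the midpoint of R₀ and b.
  set δ : ℝ := (b - R₀) / (2 * (b + 1)) with hδ
  have hb0 : 0 < b := h0.trans hb
  have hδ0 : 0 < δ := div_pos (by linarith) (by linarith)
  have hδ1 : δ ≤ 1 := by rw [hδ, div_le_one (by linarith)]; linarith
  have hlap := fun {z : ℂ} (hz : z.re < 0) => laplace_truncatedRemainder hF hlat hZ n a hz
  have hwint : Integrable fun x : ℝ => Complex.exp (-(c : ℂ) * x) * w x :=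
    (hlap (z := -(c : ℂ)) (by simpa using hc)).1
  obtain ⟨B, hB0, hB⟩ := exists_norm_integral_box_le hc hb0 hδ0 hδ1 hwint (Φ := Φ) (fun y => by
    have hz : (((-c : ℝ) : ℂ) + y * Complex.I).re < 0 := by simpa using hc
    rw [hΦ _ hz, ← (hlap hz).2]) hd hC
  obtain ⟨L, hL0, hL⟩ := exists_norm_expPolynomial_sub_le hZ n a
  have hii : ∀ x y : ℝ, IntervalIntegrable w volume x y := by
    intro x y
    have h2 := (hwint.intervalIntegrable (a := x) (b := y)).continuousOn_mul
      (g := fun u : ℝ => Complex.exp ((c : ℂ) * u)) (by fun_prop)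
    refine h2.congr fun u _ => ?_
    rw [← mul_assoc, ← Complex.exp_add]
    simp
  have hmono := monotone_renewalFunction_toReal hF hlat
  have hwx : ∀ x : ℝ, 0 < x → w x = ((renewalFunction F x).toReal : ℂ) -
      ∑ ζ ∈ Z, ∑ k ∈ Finset.range (n ζ), a ζ k * expMonomial k ζ x := fun x hx => by
    rw [hw, truncatedRemainder, Set.indicator_of_mem (Set.mem_Ioi.2 hx)]
  -- U is nondecreasing, so only the exponential polynomial can lower the real part. The imaginary
  -- part comes from that polynomial alone, so the sum of residues need not be known to be real.
  have hre : ∀ x u : ℝ, 0 < x → 0 ≤ u → u ≤ 1 →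
      (w x).re - L * Real.exp x * u ≤ (w (x + u)).re := by
    intro x u hx hu hu1
    rw [hwx x hx, hwx (x + u) (by linarith), Complex.sub_re, Complex.sub_re, Complex.ofReal_re,
      Complex.ofReal_re]
    have h1 := (Complex.re_le_norm _).trans (hL x u hx hu hu1)
    rw [Complex.sub_re] at h1
    have h2 := hmono (show x ≤ x + u by linarith)
    simp only at h2
    linarith
  have him : ∀ x u : ℝ, 0 < x → 0 ≤ u → u ≤ 1 →
      (w x).im - L * Real.exp x * u ≤ (w (x + u)).im := by
    intro x u hx hu hu1
    rw [hwx x hx, hwx (x + u) (by linarith), Complex.sub_im, Complex.sub_im, Complex.ofReal_im,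
      Complex.ofReal_im]
    have h1 := (le_abs_self _).trans ((Complex.abs_im_le_norm _).trans (hL x u hx hu hu1))
    rw [Complex.sub_im] at h1
    linarith
  have hire : ∀ x y : ℝ, ∫ u in x..y, (w u).re = (∫ u in x..y, w u).re := fun x y =>
    Complex.reCLM.intervalIntegral_comp_comm (hii x y)
  have hiim : ∀ x y : ℝ, ∫ u in x..y, (w u).im = (∫ u in x..y, w u).im := fun x y =>
    Complex.imCLM.intervalIntegral_comp_comm (hii x y)
  have hr : R₀ < b - δ * (b + 1) := by
    have : δ * (b + 1) = (b - R₀) / 2 := by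
      rw [hδ]
      have : b + 1 ≠ 0 := by linarith
      field_simp
    linarith
  refine ⟨2 * (B * Real.exp b + L), b - δ * (b + 1), hr, fun x hx => ?_⟩
  have h1 := abs_le_exp_of_integral_box_le (s := fun x => (w x).re) hL0 hB0 hb0.le hδ0.le hre
    (fun x y => ⟨(hii x y).1.re, (hii x y).2.re⟩)
    (fun x η hη => by
      rw [hire]
      exact (Complex.abs_re_le_norm _).trans (hB x η hη)) hx
  have h2 := abs_le_exp_of_integral_box_le (s := fun x => (w x).im) hL0 hB0 hb0.le hδ0.le him
    (fun x y => ⟨(hii x y).1.im, (hii x y).2.im⟩)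
    (fun x η hη => by
      rw [hiim]
      exact (Complex.abs_im_le_norm _).trans (hB x η hη)) hx
  have h3 := Complex.norm_le_abs_re_add_abs_im (w x)
  linarith

/-- The renewal function is a sum of residues up to an exponentially smaller error. -/
lemma exists_norm_renewalFunction_sub_residues_le {F : Measure ℝ} [IsProbabilityMeasure F]
    (hF : ∀ᵐ x ∂F, 0 ≤ x) (hlat : ¬ IsLattice F) {R₀ R₁ ε β T : ℝ} (h0 : 0 < R₀) (hε : 0 < ε)
    (hεR : R₀ + ε < R₁) (hR₁ : R₁ ∈ integrableExpSet id F) (hβ : 0 < β)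
    (hbound : ∀ z : ℂ, -ε ≤ z.re → z.re ≤ R₀ + ε → T ≤ |z.im| → β ≤ ‖1 - complexMGF id F z‖)
    {Z : Finset ℂ} (hZ : ∀ z, z ∈ Z ↔ z.re < R₀ ∧ complexMGF id F z = 1)
    (hline : ∀ z : ℂ, z.re = R₀ → complexMGF id F z ≠ 1) :
    ∃ A r, R₀ < r ∧ ∀ x : ℝ, 1 < x →
      ‖((renewalFunction F x).toReal : ℂ) - ∑ ζ ∈ Z, residue (fun z : ℂ =>
        Complex.exp (-(x : ℂ) * z) / (z * (1 - complexMGF id F z))) ζ‖ ≤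
      A * Real.exp (-r * x) := by
  have hne : ∀ z : ℂ, -ε ≤ z.re → z.re ≤ R₀ + ε → T ≤ |z.im| → complexMGF id F z ≠ 1 := by
    intro z h1 h2 h3 h4
    have := hbound z h1 h2 h3
    rw [h4, sub_self, norm_zero] at this
    linarith
  have hfin : {z : ℂ | z.re ≤ R₀ + ε ∧ complexMGF id F z = 1}.Finite :=
    finite_complexMGF_eq_one hF hlat hεR (by linarith) hR₁
      fun z h1 h2 h3 => hne z (by linarith) h2 h3
  -- Only finitely many zeros have real part at most R₀ + ε and none lies on Re z = R₀, so b fits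
  -- strictly before the next one.
  obtain ⟨b, hbR, hbε, hb⟩ : ∃ b, R₀ < b ∧ b < R₀ + ε ∧
      ∀ z : ℂ, z.re ≤ b → complexMGF id F z = 1 → z ∈ Z := by
    have h1 : ∀ᶠ b in 𝓝[>] R₀, ∀ z ∈ {z : ℂ | z.re ≤ R₀ + ε ∧ complexMGF id F z = 1},
        R₀ < z.re → b < z.re := by
      rw [eventually_all_finite hfin]
      intro z _
      by_cases h : R₀ < z.re
      · filter_upwards [Ioo_mem_nhdsGT h] with b hb _ using hb.2
      · exact Eventually.of_forall fun b h' => absurd h' h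
    obtain ⟨b, h1, h2⟩ := (h1.and (Ioo_mem_nhdsGT (show R₀ < R₀ + ε by linarith))).exists
    refine ⟨b, h2.1, h2.2, fun z hz hz1 => (hZ z).2 ⟨?_, hz1⟩⟩
    rcases lt_trichotomy z.re R₀ with h | h | h
    · exact h
    · exact absurd hz1 (hline z h)
    · exact absurd (h1 z ⟨by linarith [h2.2], hz1⟩ h) (not_lt.2 hz)
  have han : ∀ z : ℂ, z.re ≤ b → AnalyticAt ℂ (complexMGF id F) z := fun z hz =>
    analyticAt_complexMGF (mem_interior_integrableExpSet_of_lt hF (by linarith) hR₁)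
  have hZre : ∀ ζ ∈ Z, 0 ≤ ζ.re := by
    intro ζ hζ
    by_contra hneg
    have := eq_zero_of_complexMGF_eq_one hF hlat (not_le.1 hneg).le ((hZ ζ).1 hζ).2
    simp [this] at hneg
  have hZb : ∀ ζ ∈ Z, ζ.re ≤ b := fun ζ hζ => by linarith [((hZ ζ).1 hζ).1]
  have h0Z : (0 : ℂ) ∈ Z := (hZ 0).2 ⟨by simpa using h0, complexMGF_zero_eq_one F⟩
  obtain ⟨n, a, H, hH, hHZ, hHan, hpart⟩ := exists_sub_principalParts
    (f := fun z => 1 / (z * (1 - complexMGF id F z))) Z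
    fun ζ hζ => meromorphicAt_laplace (han ζ (hZb ζ hζ))
  have hHstrip : ∀ z : ℂ, z.re ≤ b → AnalyticAt ℂ H z := by
    intro z hz
    by_cases hzZ : z ∈ Z
    · exact hHZ z hzZ
    · refine hHan z hzZ (analyticAt_const.div (analyticAt_id.mul (analyticAt_const.sub (han z hz)))
        (mul_ne_zero ?_ ?_))
      · rintro rfl; exact hzZ h0Z
      · exact fun h => hzZ (hb z hz (sub_eq_zero.1 h).symm)
  have hHd : DifferentiableOn ℂ H {z | -ε ≤ z.re ∧ z.re ≤ b} := fun z hz =>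
    (hHstrip z hz.2).differentiableAt.differentiableWithinAt
  -- The threshold guarantees |Im z| ≥ 1 and |Im z| ≥ 2|Im ζ| for every pole ζ. In A, β⁻¹ comes from
  -- 1/(z(1 - g)) and the sum from the principal parts.
  obtain ⟨C, -, hC⟩ := exists_bound_div_one_add_abs_im
    (T := max T (1 + ∑ ζ ∈ Z, 2 * |ζ.im|))
    (A := β⁻¹ + ∑ ζ ∈ Z, ∑ k ∈ Finset.range (n ζ), ‖a ζ k‖ * 2 ^ (k + 1))
    ((le_add_of_nonneg_right (Finset.sum_nonneg fun ζ _ => by positivity)).trans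
      (le_max_right _ _)) hHd.continuousOn (fun z h1 h2 h3 => by
      have hT : T ≤ |z.im| := (le_max_left _ _).trans h3
      have hs : 1 + ∑ ζ ∈ Z, 2 * |ζ.im| ≤ |z.im| := (le_max_right _ _).trans h3
      have hsum0 : 0 ≤ ∑ ζ ∈ Z, 2 * |ζ.im| := Finset.sum_nonneg fun ζ _ => by positivity
      have hone : 1 ≤ |z.im| := by linarith
      have hpos : 0 < |z.im| := by linarith
      have hzZ : z ∉ Z := fun h => hne z h1 (by linarith) hT ((hZ z).1 h).2
      rw [hH z hzZ, add_div]
      refine (norm_sub_le _ _).trans (add_le_add ?_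
        (norm_sum_principalParts_le Z n a hone fun ζ hζ => ?_))
      · rw [norm_div, norm_one, norm_mul, one_div, mul_inv, ← div_eq_inv_mul, div_eq_mul_inv,
          div_eq_mul_inv]
        gcongr
        · exact hbound z h1 (by linarith) hT
        · exact Complex.abs_im_le_norm z
      · have := Finset.single_le_sum (f := fun ζ : ℂ => 2 * |ζ.im|)
          (fun ζ _ => by positivity) hζ
        linarith)
  obtain ⟨A, r, hr, hA⟩ := exists_norm_truncatedRemainder_le hF hlat hZre n a
    (Φ := fun z => -H z) hε h0 hbR
    (fun z hz => by
      rw [hH z fun h => absurd (hZre z h) (not_le.2 hz)]) hHd.neg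
    (fun z h1 h2 => by rw [norm_neg]; exact hC z h1 h2)
  refine ⟨A, r, hr, fun x hx => ?_⟩
  -- The coefficients that cancel the poles of the transform are those of the residues.
  have hres : ∑ ζ ∈ Z, residue (fun z : ℂ =>
      Complex.exp (-(x : ℂ) * z) / (z * (1 - complexMGF id F z))) ζ =
      ∑ ζ ∈ Z, ∑ k ∈ Finset.range (n ζ), a ζ k * expMonomial k ζ x := by
    refine Finset.sum_congr rfl fun ζ hζ => ?_
    obtain ⟨ρ, hρ, hfρ⟩ := hpart ζ hζ
    have h1 := hasResidue_exp_mul_principalPart hρ hfρ (x : ℂ)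
    simp only [mul_one_div] at h1
    exact h1.residue_eq
  have h := hA x hx
  rw [truncatedRemainder, Set.indicator_of_mem (Set.mem_Ioi.2 (by linarith : (0 : ℝ) < x))] at h
  rwa [hres]

end Renewal

theorem mainTheorem1
    (F : Measure ℝ) [IsProbabilityMeasure F]
    (hF_nonneg : F (Set.Iio 0) = 0)
    (hF_nonlattice : ¬ Renewal.IsLattice F)
    (hF_light : 0 < Renewal.abscissa F)
    (R₀ : ℝ) (hR₀_pos : 0 < R₀) (hR₀_lt : ENNReal.ofReal R₀ < Renewal.abscissa F)
    (hA : Renewal.UniformlyStronglyNonlattice F R₀) :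
    ∃ Z : Finset ℂ,
      (Z : Set ℂ) = {z : ℂ | z.re < R₀ ∧ complexMGF id F z = 1} ∧
      (0 : ℂ) ∈ Z ∧
      ((∀ z : ℂ, z.re = R₀ → complexMGF id F z ≠ 1) →
        (fun x : ℝ => (Renewal.renewalRemainder F x : ℂ) -
            ∑ ζ ∈ Z.erase 0, Renewal.residue
              (fun z : ℂ => Complex.exp (-(x : ℂ) * z) / (z * (1 - complexMGF id F z))) ζ)
          =o[atTop] fun x : ℝ => Real.exp (-R₀ * x)) ∧
      (∀ ζ ∈ Z.erase 0, deriv (complexMGF id F) ζ ≠ 0 → ∀ x : ℝ,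
        Renewal.residue
            (fun z : ℂ => Complex.exp (-(x : ℂ) * z) / (z * (1 - complexMGF id F z))) ζ =
          -(Complex.exp (-(x : ℂ) * ζ) / (ζ * deriv (complexMGF id F) ζ))) := by
  have hF := Renewal.ae_nonneg_of_measure_Iio hF_nonneg
  obtain ⟨R₁, h01, hR₁⟩ := Renewal.exists_mem_integrableExpSet_of_lt_abscissa hR₀_lt
  have hR₁0 : 0 < R₁ := hR₀_pos.trans h01
  obtain ⟨ε, hε, hεR, β, hβ, T, hbound⟩ :=
    Renewal.exists_bound_wider_strip hF hR₀_pos h01 hR₁ hA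
  have hfin : {z : ℂ | z.re < R₀ ∧ complexMGF id F z = 1}.Finite := by
    refine (Renewal.finite_complexMGF_eq_one hF hF_nonlattice h01 hR₁0 hR₁ (T := T)
      fun z h1 h2 h3 h4 => ?_).subset fun z hz => ⟨hz.1.le, hz.2⟩
    have := hbound z (by linarith) (by linarith) h3
    rw [h4, sub_self, norm_zero] at this
    linarith
  have hZ : ∀ z, z ∈ hfin.toFinset ↔ z.re < R₀ ∧ complexMGF id F z = 1 := fun z => by simp
  have h0Z : (0 : ℂ) ∈ hfin.toFinset :=
    (hZ 0).2 ⟨by simpa using hR₀_pos, Renewal.complexMGF_zero_eq_one F⟩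
  refine ⟨hfin.toFinset, by simp, h0Z, fun hline => ?_, fun ζ hζ hd x => ?_⟩
  · obtain ⟨A, r, hr, h⟩ := Renewal.exists_norm_renewalFunction_sub_residues_le hF hF_nonlattice
      hR₀_pos hε hεR hR₁ hβ hbound hZ hline
    have hO : (fun x : ℝ => (Renewal.renewalRemainder F x : ℂ) -
        ∑ ζ ∈ hfin.toFinset.erase 0, Renewal.residue
          (fun z : ℂ => Complex.exp (-(x : ℂ) * z) / (z * (1 - complexMGF id F z))) ζ)
        =O[atTop] fun x : ℝ => Real.exp (-r * x) := by
      refine IsBigO.of_bound A ?_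
      filter_upwards [eventually_gt_atTop 1] with x hx
      have h1 := h x hx
      -- Splitting off the pole at 0 turns U into v.
      rw [← Finset.add_sum_erase _ _ h0Z,
        Renewal.residue_zero_renewal hF hF_nonlattice hR₁0 hR₁] at h1
      rw [Real.norm_eq_abs, Real.abs_exp]
      refine le_trans (le_of_eq ?_) h1
      congr 1
      rw [Renewal.renewalRemainder]
      push_cast
      ring
    refine hO.trans_isLittleO ?_
    rw [Real.isLittleO_exp_comp_exp_comp]
    have : (fun x : ℝ => -R₀ * x - -r * x) = fun x : ℝ => (r - R₀) * x := by
      ext x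
      ring
    rw [this]
    exact tendsto_id.const_mul_atTop (sub_pos.2 hr)
  · have hζ' := (hZ ζ).1 (Finset.mem_of_mem_erase hζ)
    exact (Renewal.hasResidue_of_simple_zero
      (analyticAt_complexMGF (Renewal.mem_interior_integrableExpSet_of_lt hF
        (hζ'.1.trans h01) hR₁)) (Finset.ne_of_mem_erase hζ) hζ'.2 hd x).residue_eq
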